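/- **Game.** Let $\Gamma$ be a multi-stage game with players $\mathcal N=\{1,\dots,N\}$, nature $0$, and stages $1,\dots,T$ ($T\ge 1$). All action spaces $\mathcal A_{jt}$ ($0\le j\le N$) and signal spaces $S_{jt}$ ($1\le j\le N$) are finite products of bounded closed intervals, and $S_{j1}$ is a singleton. In stage $t$, after the history $a_{<t}$, nature draws from a transition probability $p_t(\cdot\mid a_{<t})$ on $\mathcal A_{0t}$, and simultaneously and independently every player $j$ draws from $\beta_{jt}(\cdot\mid\sigma_{jt}(a_{<t}))$, where $\sigma_{jt}:\mathcal A_{<t}\to S_{jt}$ is her signal function and her strategy $\beta_j=(\beta_{jt})_t\in\Sigma_j$ consists of transition probabilities from $S_{jt}$ to $\mathcal A_{jt}$. This defines the outcome law $P(\cdot\mid\beta)$ on the set $\mathcal A$ of outcomes. Utilities $u_j:\mathcal A\to\mathbb R$ are bounded and measurable, and $\tilde u_j(\beta)=\int u_j\,dP(\cdot\mid\beta)$. Let $\Sigma_i^{\mathrm{Lip,p}}$ be the set of strategies of player $i$ that are pure (all values are Dirac measures) and Lipschitz in the 1-Wasserstein distance $d_W$ in every stage, and $$\tilde\ell_i^{\mathrm{Lip,p}}(\beta)=\sup_{\beta_i'\in\Sigma_i^{\mathrm{Lip,p}}}\tilde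 u_i(\beta_i',\beta_{-i})-\tilde u_i(\beta).$$ **Grids.** For $D\in\mathbb N$, each interval $[c,d]$ is divided into $2^D$ half-open cells of equal length (the last one also contains $d$), whose left endpoints are its grid points; products give the grid cells of $S_{it}$ and the finite set $\mathcal A_{it}^D$ of grid actions (a degenerate interval has one cell and one grid point). $\Sigma_i^D$ is the set of step functions, which in every stage choose a grid action that depends only on the grid cell of the signal. Put $$\varepsilon_D=\sup_{\Sigma_i^{\mathrm{Lip,p}}}\tilde u_i(\cdot,\beta_{-i})-\sup_{\Sigma_i^D}\tilde u_i(\cdot,\beta_{-i}).$$ **Assumptions.** (a) Perfect recall: for $t<r$, a player's signal $\sigma_{jt}(a_{<t})$ and action $a_{jt}$ are measurable functions of $\sigma_{jr}(a_{<r})$. (b) Perfect recall of player $i$ is visible on the grids: for every $D$ and $t<r$, among the histories in which $i$ has only played grid actions, the grid cell of $\sigma_{ir}(a_{<r})$ determines $a_{it}$ and the grid cell of $\sigma_{it}(a_{<t})$; this holds, for example, if $s_{it}$ and $a_{it}$ are appended as coordinates to $s_{i,t+1}$. (c) All $\sigma_{jt}$ are Lipschitz, and each $a_{<t}\mapsto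 p_t(\cdot\mid a_{<t})$ is Lipschitz with respect to $d_W$. (d) $u_i$ is continuous. (e) $\beta_i\in\Sigma_i$ is arbitrary, and $\beta_{jt}$ is Lipschitz with respect to $d_W$ for all $j\ne i$ and all $t$. **Verifier.** Fix $D$. A simulation tree contains, for every stage $t$ and every sequence of earlier grid actions of $i$ (a node), one sample of the moves of nature and the opponents, drawn by $p_t$ and $\beta_{-i}$ given the history of the node, independently across the nodes. Every sequence of grid actions of $i$ thus yields one simulated complete history per tree. Let $A_M$ be the first $M$ trees of an i.i.d. sequence of such trees, and $B_M$ the first $M$ members of an i.i.d. sequence of outcomes with law $P(\cdot\mid\beta)$. For a cell $C$ of $S_{it}$, let $M(C)$ be the number of simulated stage-$t$ nodes in $A_M$ whose signal lies in $C$. For a grid action $x$ and a step function $b$, let $\hat u^{c}(b_{>t}\mid C,x)$ be $1/M(C)$ times the sum of $u_i$ over the simulated complete histories in $A_M$ whose stage-$t$ signal lies in $C$, in which $i$ plays $x$ in stage $t$ and plays according to $b$ in all later stages (zero if $M(C)=0$). Let $\beta_i^{D,M}\in\Sigma_i^D$ be obtained by backward induction, i.e. in every cell $C$ of every stage it plays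 a maximizer $x$ of $\hat u^c(\beta_{i,>t}^{D,M}\mid C,x)$, with arbitrary tie-breaking. Let $$\hat u_i^{\mathrm{ver},D}(\beta_{-i}\mid A_M)=\sum_{C}\frac{M(C)}{\sum_{C'}M(C')}\,\hat u^c\bigl(\beta_{i,>1}^{D,M}\mid C,\beta_{i1}^{D,M}(C)\bigr),$$ summed over the cells of $S_{i1}$, and $$\varepsilon_{M}=\sup_{\Sigma_i^D}\tilde u_i(\cdot,\beta_{-i})-\hat u_i^{\mathrm{ver},D}(\beta_{-i}\mid A_M),\qquad \ell_i^{\mathrm{ver}}(\beta)=\hat u_i^{\mathrm{ver},D}(\beta_{-i}\mid A_M)-\frac1M\sum_{a\in B_M}u_i(a).$$ **Theorem.** Under these assumptions, $\lim_{D\to\infty}\varepsilon_D$ exists and is $\le 0$; for every $D$, $\lim_{M\to\infty}\varepsilon_M=0$ almost surely; and almost surely the limit $\lim_{M\to\infty}\ell_i^{\mathrm{ver}}(\beta)$ exists for every $D$, the iterated limit exists, and $$\lim_{D\to\infty}\lim_{M\to\infty}\ell_i^{\mathrm{ver}}(\beta)\ \ge\ \tilde\ell_i^{\mathrm{Lip,p}}(\beta).$$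 -/

import Mathlib

open MeasureTheory ProbabilityTheory Filter Topology
open scoped NNReal ENNReal

noncomputable section

/-! ### Wasserstein distance and Lipschitz transition probabilities -/

/-- The 1-Wasserstein distance: the infimum of `∫ d(x, y) dπ(x, y)` over all couplings `π` of
`μ` and `ν`. -/
def wassersteinDist {X : Type*} [PseudoEMetricSpace X] [MeasurableSpace X]
    (μ ν : Measure X) : ℝ≥0∞ :=
  ⨅ (π : Measure (X × X)) (_ : π.fst = μ ∧ π.snd = ν), ∫⁻ z, edist z.1 z.2 ∂π

/-- The transition probability `κ` is Lipschitz continuous for the Wasserstein distance. -/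
def WassersteinLipschitz {X Y : Type*} [PseudoEMetricSpace X] [MeasurableSpace X]
    [PseudoEMetricSpace Y] [MeasurableSpace Y] (κ : Kernel X Y) : Prop :=
  ∃ K : ℝ≥0, ∀ x x' : X, wassersteinDist (κ x) (κ x') ≤ K * edist x x'

/-! ### Finite products of transition probabilities and sequential sampling -/

/-- The product of finitely many transition probabilities (conditionally independent
coordinates). -/
def piKernel {ι X : Type*} [Fintype ι] {Y : ι → Type*} [MeasurableSpace X]
    [∀ j, MeasurableSpace (Y j)] (κ : ∀ j, Kernel X (Y j)) [∀ j, IsMarkovKernel (κ j)] :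
    Kernel X (∀ j, Y j) where
  toFun x := Measure.pi fun j => κ j x
  measurable' := by
    refine Measurable.measure_of_isPiSystem_of_isProbabilityMeasure generateFrom_pi.symm
      isPiSystem_pi ?_
    rintro _ ⟨s, hs, rfl⟩
    simp only [Measure.pi_pi]
    exact Finset.measurable_prod _ fun j _ =>
      Kernel.measurable_coe (κ j) (hs j (Set.mem_univ j))

instance {ι X : Type*} [Fintype ι] {Y : ι → Type*} [MeasurableSpace X]
    [∀ j, MeasurableSpace (Y j)] (κ : ∀ j, Kernel X (Y j)) [∀ j, IsMarkovKernel (κ j)] :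
    IsMarkovKernel (piKernel κ) :=
  ⟨fun x => by change IsProbabilityMeasure (Measure.pi fun j => κ j x); infer_instance⟩

/-- What has happened strictly before stage `t`, when stage `s` produces an element of `X s`.
Stages are numbered `0, …, T - 1`. -/
abbrev Before {T : ℕ} (X : Fin T → Type) (t : Fin T) : Type :=
  ∀ s : Fin (t : ℕ), X (s.castLE t.2.le)

/-- The part of a complete sequence that lies strictly before stage `t`. -/
def before {T : ℕ} {X : Fin T → Type} (a : ∀ s, X s) (t : Fin T) : Before X t :=
  fun s => a (s.castLE t.2.le)

/-- The law of the first `t` stages when stage `s` is drawn from `κ s`, given all previous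
stages. -/
def sequentialLaw {T : ℕ} (X : Fin T → Type) [∀ t, MeasurableSpace (X t)]
    (κ : ∀ t : Fin T, Kernel (Before X t) (X t)) :
    ∀ (t : ℕ) (ht : t ≤ T), Measure (∀ s : Fin t, X (s.castLE ht))
  | 0, _ => Measure.dirac fun s => s.elim0
  | t + 1, ht =>
      ((sequentialLaw X κ t (Nat.le_of_succ_le ht)) ⊗ₘ (κ ⟨t, ht⟩)).map fun z =>
        Fin.snoc (α := fun s : Fin (t + 1) => X (s.castLE ht)) z.1 z.2

/-! ### Boxes and regular grids -/

/-- A product of finitely many bounded closed intervals `[lo r, hi r]`. -/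
structure Box where
  dim : ℕ
  lo : Fin dim → ℝ
  hi : Fin dim → ℝ
  lo_le_hi : ∀ r, lo r ≤ hi r

namespace Box

/-- The points of the box, with the metric of the maximum norm. -/
abbrev Pt (B : Box) : Type := Set.Icc B.lo B.hi

/-- Indices of the cells (and of the grid points) of the regular grid of precision `D`, which has
`2 ^ D` points along each dimension. -/
abbrev Idx (B : Box) (D : ℕ) : Type := Fin B.dim → Fin (2 ^ D)

/-- The cell that contains `x`. Along an interval `[lo, hi]` with `w = (hi - lo) / 2 ^ D`, the cell
with index `k` is `[lo + k * w, lo + (k + 1) * w)`, except that the last cell also contains `hi`.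
A degenerate interval has only one nonempty cell. -/
def cell (B : Box) (D : ℕ) (x : B.Pt) : B.Idx D := fun r =>
  ⟨min ⌊2 ^ D * ((x.1 r - B.lo r) / (B.hi r - B.lo r))⌋₊ (2 ^ D - 1), by
    have : 0 < 2 ^ D := by positivity
    omega⟩

theorem measurable_cell (B : Box) (D : ℕ) : Measurable (B.cell D) := by
  refine measurable_pi_lambda _ fun r => ?_
  have hf : Measurable fun x : B.Pt => ⌊2 ^ D * ((x.1 r - B.lo r) / (B.hi r - B.lo r))⌋₊ := by
    refine Nat.measurable_floor.comp ?_
    have h : Measurable fun x : B.Pt => x.1 r := (measurable_pi_apply r).comp measurable_subtype_coe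
    exact ((h.sub_const _).div_const _).const_mul _
  have hg : Measurable fun n : ℕ => (⟨min n (2 ^ D - 1), by
    have : 0 < 2 ^ D := by positivity
    omega⟩ : Fin (2 ^ D)) := measurable_of_countable _
  exact hg.comp hf

/-- The grid point with index `k`: the lower corner of the `k`-th cell. -/
def gridPt (B : Box) (D : ℕ) (k : B.Idx D) : B.Pt :=
  ⟨fun r => B.lo r + (k r : ℕ) * ((B.hi r - B.lo r) / 2 ^ D), by
    have h2 : (0 : ℝ) < 2 ^ D := by positivity
    refine ⟨fun r => ?_, fun r => ?_⟩
    · have h := sub_nonneg.2 (B.lo_le_hi r)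
      have : 0 ≤ ((k r : ℕ) : ℝ) * ((B.hi r - B.lo r) / 2 ^ D) := by positivity
      linarith
    · have h := sub_nonneg.2 (B.lo_le_hi r)
      have hk : ((k r : ℕ) : ℝ) ≤ 2 ^ D := by exact_mod_cast (k r).2.le
      have : ((k r : ℕ) : ℝ) * ((B.hi r - B.lo r) / 2 ^ D) ≤
          2 ^ D * ((B.hi r - B.lo r) / 2 ^ D) := by gcongr
      rw [mul_div_cancel₀ _ h2.ne'] at this
      linarith⟩

open Classical in
/-- The finite set of grid points of precision `D`. -/
def grid (B : Box) (D : ℕ) : Finset B.Pt := Finset.univ.image (B.gridPt D)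

end Box

/-! ### Multi-stage games -/

/-- Action profiles of a stage: nature is `none`, player `j` is `some j`. -/
abbrev ActProfile {N T : ℕ} (action : Option (Fin N) → Fin T → Box) (t : Fin T) : Type :=
  ∀ j : Option (Fin N), (action j t).Pt

/-- A multi-stage game with `N` players, nature and `T` stages, whose signal and action spaces are
products of bounded closed intervals. In stage `t`, nature and all players move simultaneously,
knowing (signals of) the history `a_{<t}`. -/
structure MultiStageGame (N T : ℕ) where
  /-- There is at least one stage. -/
  T_pos : 0 < T
  /-- Action spaces of nature (`none`) and of the players (`some j`). -/
  action : Option (Fin N) → Fin T → Box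
  /-- Signal spaces. -/
  signal : Fin N → Fin T → Box
  /-- In the first stage there is only one signal. -/
  signal_first : ∀ j, (signal j ⟨0, T_pos⟩).lo = (signal j ⟨0, T_pos⟩).hi
  /-- Nature's transition probabilities. -/
  nature : ∀ t : Fin T, Kernel (Before (ActProfile action) t) (action none t).Pt
  nature_markov : ∀ t, IsMarkovKernel (nature t)
  /-- Signal functions. -/
  sig : ∀ (j : Fin N) (t : Fin T), Before (ActProfile action) t → (signal j t).Pt
  measurable_sig : ∀ j t, Measurable (sig j t)
  /-- Utility functions. -/
  utility : Fin N → (∀ t : Fin T, ActProfile action t) → ℝ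
  measurable_utility : ∀ j, Measurable (utility j)
  bounded_utility : ∀ j, ∃ C : ℝ, ∀ a, |utility j a| ≤ C

namespace MultiStageGame

variable {N T : ℕ} (G : MultiStageGame N T)

/-- Histories `a_{<t}`. -/
abbrev History (t : Fin T) : Type := Before (ActProfile G.action) t

/-- Outcomes, that is, complete roll-outs of the game. -/
abbrev Outcome : Type := ∀ t : Fin T, ActProfile G.action t

/-- Strategies of player `j`: a transition probability from signals to actions in every stage. -/
abbrev Strategy (j : Fin N) : Type :=
  ∀ t : Fin T, {κ : Kernel (G.signal j t).Pt (G.action (some j) t).Pt // IsMarkovKernel κ}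

/-- Strategy profiles. -/
abbrev Profile : Type := ∀ j : Fin N, G.Strategy j

/-- The distribution of participant `j`'s stage-`t` action, given the history: nature follows
`nature t`, player `j` plays `β j t` on her signal. -/
def moveKernel (β : G.Profile) (t : Fin T) :
    ∀ j : Option (Fin N), Kernel (G.History t) (G.action j t).Pt
  | none => G.nature t
  | some j => (β j t).1.comap (G.sig j t) (G.measurable_sig j t)

instance (β : G.Profile) (t : Fin T) (j : Option (Fin N)) :
    IsMarkovKernel (G.moveKernel β t j) := by
  cases j with
  | none => exact G.nature_markov t
  | some j =>
    have := (β j t).2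
    change IsMarkovKernel ((β j t).1.comap (G.sig j t) (G.measurable_sig j t))
    infer_instance

/-- The measure `P(· | β)` over outcomes: in every stage, nature's and the players' actions are
drawn independently of each other given the history. -/
def outcomeLaw (β : G.Profile) : Measure G.Outcome :=
  sequentialLaw (ActProfile G.action) (fun t => piKernel (G.moveKernel β t)) T le_rfl

/-- Player `i`'s ex-ante utility. -/
def exAnte (i : Fin N) (β : G.Profile) : ℝ := ∫ a, G.utility i a ∂(G.outcomeLaw β)

/-- Perfect recall: from a signal, a player can recover her earlier signals and actions. -/
def PerfectRecall : Prop :=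
  ∀ (j : Fin N) (t r : Fin T), t < r →
    ∃ (Ψ : (G.signal j r).Pt → (G.signal j t).Pt)
      (ψ : (G.signal j r).Pt → (G.action (some j) t).Pt), Measurable Ψ ∧ Measurable ψ ∧
      ∀ a : G.Outcome, Ψ (G.sig j r (before a r)) = G.sig j t (before a t) ∧
        ψ (G.sig j r (before a r)) = a t (some j)

/-- All signal functions are Lipschitz continuous. -/
def LipschitzSignals : Prop := ∀ j t, ∃ K : ℝ≥0, LipschitzWith K (G.sig j t)

/-- Nature's transition probabilities are Lipschitz continuous in the Wasserstein distance. -/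
def LipschitzNature : Prop := ∀ t, WassersteinLipschitz (G.nature t)

/-- The set of pure Lipschitz continuous strategies of player `i`. -/
def pureLipschitz (i : Fin N) : Set (G.Strategy i) :=
  {b | ∀ t, WassersteinLipschitz (b t).1 ∧ ∀ s, ∃ a, (b t).1 s = Measure.dirac a}

/-- The utility loss of player `i` with respect to pure Lipschitz continuous strategies. -/
def utilityLoss (i : Fin N) (β : G.Profile) : ℝ :=
  sSup ((fun b => G.exAnte i (Function.update β i b)) '' G.pureLipschitz i) - G.exAnte i β

/-! ### Step functions -/

/-- The grid cell of player `j`'s stage-`t` signal after the history `h`. -/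
def sigCell (j : Fin N) (D : ℕ) (t : Fin T) (h : G.History t) : (G.signal j t).Idx D :=
  (G.signal j t).cell D (G.sig j t h)

/-- Grid actions of player `i` in stage `t`. -/
abbrev GridAct (i : Fin N) (D : ℕ) (t : Fin T) : Type := ↥((G.action (some i) t).grid D)

/-- Step functions: a grid action for every signal grid cell of every stage. -/
abbrev StepFn (i : Fin N) (D : ℕ) : Type :=
  ∀ t : Fin T, (G.signal i t).Idx D → G.GridAct i D t

/-- A step function as a (pure) strategy. -/
def stepStrategy (i : Fin N) (D : ℕ) (b : G.StepFn i D) : G.Strategy i := fun t =>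
  ⟨Kernel.deterministic (fun s => (b t ((G.signal i t).cell D s)).1)
    ((measurable_of_countable fun k => (b t k).1).comp ((G.signal i t).measurable_cell D)),
    inferInstance⟩

/-- The largest ex-ante utility of a step function of precision `D` against `β_{-i}`. -/
def stepSup (i : Fin N) (D : ℕ) (β : G.Profile) : ℝ :=
  sSup (Set.range fun b : G.StepFn i D =>
    G.exAnte i (Function.update β i (G.stepStrategy i D b)))

/-- The discretization error. -/
def discretizationError (i : Fin N) (D : ℕ) (β : G.Profile) : ℝ :=
  sSup ((fun b => G.exAnte i (Function.update β i b)) '' G.pureLipschitz i) - G.stepSup i D β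

/-- Player `i`'s recall is visible on the grids: as long as she has only played grid actions, the
grid cell of her signal determines the actions that she took and the grid cells that she observed
in all previous stages. (This holds, for example, if the signal `s_{i,t+1}` has the coordinates of
`s_{it}` and `a_{it}`, over the same intervals, among its own.) -/
def GridRecall (i : Fin N) : Prop :=
  ∀ (D : ℕ) (t r : Fin T), t < r → ∀ a a' : G.Outcome,
    (∀ s < r, a s (some i) ∈ (G.action (some i) s).grid D ∧
      a' s (some i) ∈ (G.action (some i) s).grid D) →
    G.sigCell i D r (before a r) = G.sigCell i D r (before a' r) →
    a t (some i) = a' t (some i) ∧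
      G.sigCell i D t (before a t) = G.sigCell i D t (before a' t)

/-! ### The simulation phase -/

/-- Stage-`t` actions of nature and of the opponents of `i`. -/
abbrev Others (i : Fin N) (t : Fin T) : Type :=
  ∀ j : {j : Option (Fin N) // j ≠ some i}, (G.action j.1 t).Pt

/-- Nodes of stage `t` of the simulation tree: the sequences of grid actions that player `i` may
have taken before. -/
abbrev Node (i : Fin N) (D : ℕ) (t : Fin T) : Type := Before (G.GridAct i D) t

/-- The simulated moves of stage `t`: one sample of the actions of nature and the opponents for
every node. -/
abbrev Draws (i : Fin N) (D : ℕ) (t : Fin T) : Type := G.Node i D t → G.Others i t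

/-- A simulation tree, which comes from one initial state by exploring all grid actions of `i`. -/
abbrev Tree (i : Fin N) (D : ℕ) : Type := ∀ t : Fin T, G.Draws i D t

/-- The action profile in which `i` plays `x` and the others play `y`. -/
def join (i : Fin N) (t : Fin T) (x : (G.action (some i) t).Pt) (y : G.Others i t) :
    ActProfile G.action t :=
  (Equiv.piSplitAt (some i) fun j => (G.action j t).Pt).symm (x, y)

/-- The history at the node `c` of stage `t` of a tree that is simulated up to stage `t`. -/
def nodeHistory (i : Fin N) (D : ℕ) (t : Fin T) (c : G.Node i D t)
    (τ : Before (G.Draws i D) t) : G.History t := fun s =>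
  G.join i (s.castLE t.2.le) (c s).1 (τ s fun q => c (q.castLE s.2.le))

theorem measurable_nodeHistory (i : Fin N) (D : ℕ) (t : Fin T) (c : G.Node i D t) :
    Measurable (G.nodeHistory i D t c) := by
  refine measurable_pi_lambda _ fun s => measurable_pi_lambda _ fun j => ?_
  by_cases h : j = some i
  · subst h
    simp only [nodeHistory, join, Equiv.piSplitAt, Equiv.coe_fn_symm_mk, dite_true]
    exact measurable_const
  · simp only [nodeHistory, join, Equiv.piSplitAt, Equiv.coe_fn_symm_mk, dif_neg h]
    exact (measurable_pi_apply _).comp ((measurable_pi_apply _).comp (measurable_pi_apply s))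

/-- The law of the moves of nature and the opponents, given the history. -/
def othersKernel (i : Fin N) (β : G.Profile) (t : Fin T) : Kernel (G.History t) (G.Others i t) :=
  piKernel fun j : {j : Option (Fin N) // j ≠ some i} => G.moveKernel β t j.1

instance (i : Fin N) (β : G.Profile) (t : Fin T) : IsMarkovKernel (G.othersKernel i β t) := by
  unfold othersKernel
  infer_instance

/-- The law of a simulation tree: at every node of stage `t`, nature and the opponents move
according to the history of the node, independently across the nodes. -/
def treeLaw (i : Fin N) (D : ℕ) (β : G.Profile) : Measure (G.Tree i D) :=
  sequentialLaw (G.Draws i D) (fun t => piKernel fun c : G.Node i D t =>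
    (G.othersKernel i β t).comap (G.nodeHistory i D t c) (G.measurable_nodeHistory i D t c))
    T le_rfl

/-- The complete history in the tree `τ` along the sequence `c` of grid actions of `i`. -/
def branch (i : Fin N) (D : ℕ) (τ : G.Tree i D) (c : ∀ t, G.GridAct i D t) : G.Outcome :=
  fun t => G.join i t (c t).1 (τ t (before c t))

/-! ### The aggregation phase, for trees `τ 0, …, τ (M - 1)` -/

section Aggregation

variable (i : Fin N) (D : ℕ) {M : ℕ} (τ : Fin M → G.Tree i D)

/-- The visitation count of the cell `k` of stage `t`. -/
def visits (t : Fin T) (k : (G.signal i t).Idx D) : ℕ :=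
  Nat.card {x : Fin M × G.Node i D t //
    G.sigCell i D t (G.nodeHistory i D t x.2 (before (τ x.1) t)) = k}

open Classical in
/-- The simulated complete histories that reach the cell `k` in stage `t`, where `i` then plays
`x`, and follows the step function `b` in all later stages. A simulated history is given by its
tree and its sequence of grid actions. -/
def simulated (b : G.StepFn i D) (t : Fin T) (k : (G.signal i t).Idx D) (x : G.GridAct i D t) :
    Finset (Fin M × (∀ t, G.GridAct i D t)) :=
  Finset.univ.filter fun l =>
    G.sigCell i D t (before (G.branch i D (τ l.1) l.2) t) = k ∧ l.2 t = x ∧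
      ∀ r, t < r → b r (G.sigCell i D r (before (G.branch i D (τ l.1) l.2) r)) = l.2 r

/-- The estimated counterfactual conditional utility (zero for a cell without visits). -/
def condUtility (b : G.StepFn i D) (t : Fin T) (k : (G.signal i t).Idx D)
    (x : G.GridAct i D t) : ℝ :=
  (∑ l ∈ G.simulated i D τ b t k x, G.utility i (G.branch i D (τ l.1) l.2)) / G.visits i D τ t k

/-- The step function `b` results from backward induction on the simulated data: in every cell it
takes a grid action of maximal estimated counterfactual conditional utility, given its own
behavior in the later stages. -/
def IsBackwardInduction (b : G.StepFn i D) : Prop :=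
  ∀ t k x, G.condUtility i D τ b t k x ≤ G.condUtility i D τ b t k (b t k)

/-- The estimated best-response utility of the step function `b` from backward induction. -/
def estimatedBestResponse (b : G.StepFn i D) : ℝ :=
  ∑ k, (G.visits i D τ ⟨0, G.T_pos⟩ k : ℝ) / (∑ k', (G.visits i D τ ⟨0, G.T_pos⟩ k' : ℝ)) *
    G.condUtility i D τ b ⟨0, G.T_pos⟩ k (b ⟨0, G.T_pos⟩ k)

/-- The simulation error, against `β_{-i}`. -/
def simulationError (β : G.Profile) (b : G.StepFn i D) : ℝ :=
  G.stepSup i D β - G.estimatedBestResponse i D τ b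

/-- The verifier's estimate of the utility loss, from the trees `τ` and the complete histories
`y 0, …, y (M - 1)`. -/
def estimatedLoss (b : G.StepFn i D) (y : Fin M → G.Outcome) : ℝ :=
  G.estimatedBestResponse i D τ b - (∑ m, G.utility i (y m)) / M

end Aggregation

end MultiStageGame

end

/-! Discretization and simulation are separate problems that meet in `stepSup`, the best utility of
a step function of precision `D`.

Discretization: the grids are nested, so `stepSup` increases with `D` and, utilities being bounded,
converges (`exists_tendsto_stepSup`). A pure Lipschitz strategy amounts to Lipschitz maps, which
step functions approximate uniformly. Nature, the opponents and the approximated strategy are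
Lipschitz and the utility is continuous on a compact space, so expected utility is stable under this
approximation (`tendsto_integral_sequentialLaw`). Hence the limit of `stepSup` dominates every pure
Lipschitz strategy.

Simulation: a step function selects exactly one branch of each tree. Each stage of this branch reads
one fresh draw, at a node fixed by earlier draws, so the branch has the law of actual play
(`map_path_treeLaw`). By the law of large numbers the branch averages of the finitely many step
functions converge simultaneously. Grid recall makes backward induction an exact maximizer of these
averages (`pathUtility_le_of_isBackwardInduction`): a cell already determines the past behavior of
`i`, so the stages can be optimized one at a time. The verifier's estimate is this maximal average
(`estimatedBestResponse_eq`) and converges to `stepSup`. Subtracting the average utility over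
roll-outs of `β` gives the estimated loss. -/

noncomputable section

/-! ### Wasserstein distance -/

section Wasserstein

variable {X Y : Type*}

/-- Every coupling of two Dirac measures is concentrated on the single pair `(a, b)`. This turns a
pure Lipschitz kernel into a Lipschitz map. -/
theorem edist_le_wassersteinDist_dirac [PseudoEMetricSpace X] [MeasurableSpace X]
    [OpensMeasurableSpace X] [SecondCountableTopology X] [MeasurableSingletonClass X] (a b : X) :
    edist a b ≤ wassersteinDist (Measure.dirac a) (Measure.dirac b) := by
  refine le_iInf₂ fun π hπ => ?_
  have h1 : ∀ᵐ z ∂π, z.1 = a := by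
    have : ∀ᵐ x ∂π.fst, x = a := by rw [hπ.1]; simp [ae_dirac_eq]
    exact ae_of_ae_map measurable_fst.aemeasurable this
  have h2 : ∀ᵐ z ∂π, z.2 = b := by
    have : ∀ᵐ x ∂π.snd, x = b := by rw [hπ.2]; simp [ae_dirac_eq]
    exact ae_of_ae_map measurable_snd.aemeasurable this
  have hp : π Set.univ = 1 := by
    rw [← Measure.fst_univ, hπ.1]; simp
  have : ∫⁻ z, edist z.1 z.2 ∂π = ∫⁻ _, edist a b ∂π := by
    refine lintegral_congr_ae ?_
    filter_upwards [h1, h2] with z hz1 hz2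
    rw [hz1, hz2]
  rw [this]; simp [hp]

theorem wassersteinDist_dirac_le [PseudoEMetricSpace X] [MeasurableSpace X]
    [OpensMeasurableSpace X] [SecondCountableTopology X] (a b : X) :
    wassersteinDist (Measure.dirac a) (Measure.dirac b) ≤ edist a b := by
  refine iInf₂_le_of_le (Measure.dirac (a, b)) ⟨?_, ?_⟩ ?_
  · rw [Measure.fst, Measure.map_dirac' measurable_fst]
  · rw [Measure.snd, Measure.map_dirac' measurable_snd]
  · rw [lintegral_dirac' _ measurable_edist]

theorem wassersteinDist_self [PseudoEMetricSpace X] [MeasurableSpace X]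
    [OpensMeasurableSpace X] [SecondCountableTopology X] (μ : Measure X) :
    wassersteinDist μ μ = 0 := by
  refine le_antisymm ?_ zero_le
  have hm : Measurable fun x : X => (x, x) := measurable_id.prodMk measurable_id
  refine iInf₂_le_of_le (μ.map fun x => (x, x)) ⟨?_, ?_⟩ ?_
  · rw [Measure.fst, Measure.map_map measurable_fst hm]; exact Measure.map_id
  · rw [Measure.snd, Measure.map_map measurable_snd hm]; exact Measure.map_id
  · rw [lintegral_map measurable_edist hm]; simp

/-- A modulus of continuity of affine form transfers to integrals. -/
theorem enorm_integral_sub_le [PseudoEMetricSpace X] [MeasurableSpace X]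
    [OpensMeasurableSpace X] [SecondCountableTopology X]
    {μ ν : Measure X} [IsProbabilityMeasure μ]
    {f : X → ℝ} (hf : Integrable f μ) (hf' : Integrable f ν) {e c : ℝ≥0∞} (hc : c ≠ 0)
    (hc' : c ≠ ∞) (h : ∀ x y, ‖f x - f y‖ₑ ≤ e + c * edist x y) :
    ‖∫ x, f x ∂μ - ∫ x, f x ∂ν‖ₑ ≤ e + c * wassersteinDist μ ν := by
  unfold wassersteinDist
  -- With `c` neither zero nor infinite, the infimum over couplings moves outside, and it suffices
  -- to treat one coupling.
  simp only [ENNReal.mul_iInf_of_ne hc hc', ENNReal.add_iInf]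
  refine le_iInf₂ fun π hπ => ?_
  have hp : π Set.univ = 1 := by rw [← Measure.fst_univ, hπ.1]; simp
  have hfst : MeasurePreserving Prod.fst π μ := ⟨measurable_fst, hπ.1⟩
  have hsnd : MeasurePreserving Prod.snd π ν := ⟨measurable_snd, hπ.2⟩
  have i1 : Integrable (fun z : X × X => f z.1) π := hfst.integrable_comp_of_integrable hf
  have i2 : Integrable (fun z : X × X => f z.2) π := hsnd.integrable_comp_of_integrable hf'
  have e1 : ∫ x, f x ∂μ = ∫ z, f z.1 ∂π := by
    rw [← hπ.1, Measure.fst, integral_map measurable_fst.aemeasurable]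
    rw [← Measure.fst, hπ.1]; exact hf.1
  have e2 : ∫ x, f x ∂ν = ∫ z, f z.2 ∂π := by
    rw [← hπ.2, Measure.snd, integral_map measurable_snd.aemeasurable]
    rw [← Measure.snd, hπ.2]; exact hf'.1
  rw [e1, e2, ← integral_sub i1 i2]
  calc _ ≤ ∫⁻ z, ‖f z.1 - f z.2‖ₑ ∂π := enorm_integral_le_lintegral_enorm _
    _ ≤ ∫⁻ z, (e + c * edist z.1 z.2) ∂π := lintegral_mono fun z => h _ _
    _ = _ := by
      rw [lintegral_add_left measurable_const, lintegral_const_mul _ measurable_edist]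
      simp [hp]

/-- The distance of product measures is at most the sum of the distances of the factors. -/
theorem wassersteinDist_pi_le {ι : Type*} [Fintype ι] {Z : ι → Type*}
    [∀ j, PseudoEMetricSpace (Z j)] [∀ j, MeasurableSpace (Z j)]
    [∀ j, OpensMeasurableSpace (Z j)] [∀ j, SecondCountableTopology (Z j)]
    (μ ν : ∀ j, Measure (Z j)) [∀ j, IsProbabilityMeasure (μ j)] :
    wassersteinDist (Measure.pi μ) (Measure.pi ν) ≤ ∑ j, wassersteinDist (μ j) (ν j) := by
  refine ENNReal.le_of_forall_pos_le_add fun ε hε hfin => ?_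
  have hlt : ∀ j, wassersteinDist (μ j) (ν j) < ∞ := fun j =>
    (ENNReal.sum_lt_top.1 hfin) j (Finset.mem_univ j)
  -- Attainment of the infimum is not needed: each factor gets a coupling within `δ` of optimal, and
  -- the errors add up to at most `ε`.
  obtain ⟨δ, hδ, hδε⟩ : ∃ δ : ℝ≥0∞, 0 < δ ∧ Fintype.card ι * δ ≤ ε := by
    refine ⟨ε / (Fintype.card ι : ℝ≥0∞), ENNReal.div_pos (by simpa using hε.ne') (by simp), ?_⟩
    exact ENNReal.mul_div_le
  have hex : ∀ j, ∃ π : Measure (Z j × Z j), (π.fst = μ j ∧ π.snd = ν j) ∧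
      ∫⁻ z, edist z.1 z.2 ∂π < wassersteinDist (μ j) (ν j) + δ := by
    intro j
    have : wassersteinDist (μ j) (ν j) < wassersteinDist (μ j) (ν j) + δ :=
      ENNReal.lt_add_right (hlt j).ne hδ.ne'
    conv at this => lhs; unfold wassersteinDist
    simp only [iInf_lt_iff] at this
    obtain ⟨π, hπ, h⟩ := this
    exact ⟨π, hπ, h⟩
  choose π hπ hlt' using hex
  have hprob : ∀ j, IsProbabilityMeasure (π j) := fun j =>
    ⟨by rw [← Measure.fst_univ, (hπ j).1]; simp⟩
  let m : (∀ j, Z j × Z j) → (∀ j, Z j) × (∀ j, Z j) := fun z => (fun j => (z j).1, fun j => (z j).2)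
  have hm1 : Measurable fun (z : ∀ j, Z j × Z j) j => (z j).1 := by fun_prop
  have hm2 : Measurable fun (z : ∀ j, Z j × Z j) j => (z j).2 := by fun_prop
  have hm : Measurable m := hm1.prodMk hm2
  have p1 : ∀ j, IsProbabilityMeasure ((π j).map Prod.fst) := fun j =>
    Measure.isProbabilityMeasure_map measurable_fst.aemeasurable
  have p2 : ∀ j, IsProbabilityMeasure ((π j).map Prod.snd) := fun j =>
    Measure.isProbabilityMeasure_map measurable_snd.aemeasurable
  refine iInf₂_le_of_le ((Measure.pi π).map m) ⟨?_, ?_⟩ ?_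
  · rw [Measure.fst, Measure.map_map measurable_fst hm]
    refine (Measure.pi_map_pi (f := fun j => Prod.fst) fun j =>
      measurable_fst.aemeasurable).trans ?_
    congr 1; funext j; exact (hπ j).1
  · rw [Measure.snd, Measure.map_map measurable_snd hm]
    refine (Measure.pi_map_pi (f := fun j => Prod.snd) fun j =>
      measurable_snd.aemeasurable).trans ?_
    congr 1; funext j; exact (hπ j).2
  · rw [lintegral_map measurable_edist hm]
    have hme : ∀ j, Measurable fun z : Z j × Z j => edist z.1 z.2 := fun j => measurable_edist
    calc ∫⁻ z, edist (m z).1 (m z).2 ∂(Measure.pi π)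
        ≤ ∫⁻ z, ∑ j, edist (z j).1 (z j).2 ∂(Measure.pi π) := by
          refine lintegral_mono fun z => edist_pi_le_iff.2 fun j => ?_
          exact Finset.single_le_sum (f := fun j => edist (z j).1 (z j).2)
            (fun _ _ => zero_le) (Finset.mem_univ j)
      _ = ∑ j, ∫⁻ z, edist z.1 z.2 ∂(π j) := by
          have hj : ∀ j, Measurable fun z : ∀ j, Z j × Z j => edist (z j).1 (z j).2 := fun j =>
            (hme j).comp (measurable_pi_apply j)
          rw [lintegral_finsetSum _ fun j _ => hj j]
          refine Finset.sum_congr rfl fun j _ => ?_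
          exact (measurePreserving_eval π j).lintegral_comp (hme j)
      _ ≤ ∑ j, (wassersteinDist (μ j) (ν j) + δ) := Finset.sum_le_sum fun j _ => (hlt' j).le
      _ ≤ _ := by
          rw [Finset.sum_add_distrib]
          gcongr
          simpa using hδε

theorem WassersteinLipschitz.comap [PseudoEMetricSpace X] [MeasurableSpace X]
    [PseudoEMetricSpace Y] [MeasurableSpace Y] {W : Type*} [PseudoEMetricSpace W]
    [MeasurableSpace W] {κ : Kernel X Y} (hκ : WassersteinLipschitz κ) {g : W → X} {L : ℝ≥0}
    (hg : LipschitzWith L g) (hgm : Measurable g) : WassersteinLipschitz (κ.comap g hgm) := by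
  obtain ⟨K, hK⟩ := hκ
  refine ⟨K * L, fun x x' => ?_⟩
  rw [Kernel.comap_apply, Kernel.comap_apply]
  calc _ ≤ K * edist (g x) (g x') := hK _ _
    _ ≤ K * (L * edist x x') := by gcongr; exact hg x x'
    _ = _ := by push_cast; ring

theorem WassersteinLipschitz.piKernel {ι : Type*} [Fintype ι] {Z : ι → Type*}
    [∀ j, PseudoEMetricSpace (Z j)] [∀ j, MeasurableSpace (Z j)]
    [∀ j, OpensMeasurableSpace (Z j)] [∀ j, SecondCountableTopology (Z j)]
    [PseudoEMetricSpace X] [MeasurableSpace X] {κ : ∀ j, Kernel X (Z j)}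
    [∀ j, IsMarkovKernel (κ j)] (hκ : ∀ j, WassersteinLipschitz (κ j)) :
    WassersteinLipschitz (piKernel κ) := by
  choose K hK using hκ
  refine ⟨∑ j, K j, fun x x' => ?_⟩
  refine (wassersteinDist_pi_le (fun j => κ j x) (fun j => κ j x')).trans ?_
  push_cast
  rw [Finset.sum_mul]
  exact Finset.sum_le_sum fun j _ => hK j x x'

theorem integrable_of_abs_le [MeasurableSpace X] {μ : Measure X} [IsFiniteMeasure μ] {f : X → ℝ}
    (hf : Measurable f) {C : ℝ} (h : ∀ x, |f x| ≤ C) : Integrable f μ :=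
  Integrable.of_bound hf.aestronglyMeasurable C (Eventually.of_forall h)

/-- Integrals of a continuous function on a compact product depend uniformly continuously on the
parameter and (for the Wasserstein distance) on the measure. -/
theorem exists_forall_abs_integral_sub_le [PseudoMetricSpace X] [CompactSpace X]
    [PseudoMetricSpace Y] [CompactSpace Y] [MeasurableSpace Y]
    [OpensMeasurableSpace Y] [SecondCountableTopology Y] {f : X × Y → ℝ} (hf : Continuous f)
    {ε : ℝ} (hε : 0 < ε) :
    ∃ η : ℝ≥0, 0 < η ∧ ∀ (x x' : X) (μ ν : Measure Y) [IsProbabilityMeasure μ]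
      [IsProbabilityMeasure ν], edist x x' ≤ η → wassersteinDist μ ν ≤ η →
      |∫ y, f (x, y) ∂μ - ∫ y, f (x', y) ∂ν| ≤ ε := by
  obtain ⟨C, hC0, hC⟩ : ∃ C : ℝ, 0 < C ∧ ∀ z, |f z| ≤ C := by
    obtain ⟨C, hC⟩ := (isCompact_range hf).isBounded.exists_norm_le
    refine ⟨max C 1, by positivity, fun z => ?_⟩
    exact (hC _ ⟨z, rfl⟩).trans (le_max_left _ _)
  have hu := Metric.uniformContinuous_iff.1 (CompactSpace.uniformContinuous_of_continuous hf)
    (ε / 3) (by positivity)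
  obtain ⟨δ, hδ, hu⟩ := hu
  have hfx : ∀ x, Measurable fun y => f (x, y) := fun x =>
    (hf.comp (Continuous.prodMk_right x)).measurable
  have hint : ∀ x (μ : Measure Y) [IsProbabilityMeasure μ], Integrable (fun y => f (x, y)) μ :=
    fun x μ _ => integrable_of_abs_le (hfx x) fun y => hC _
  -- The first bound keeps `x` and `x'` within the modulus `δ`; the second makes the slope `2 * C /
  -- δ` cost at most `ε / 3`.
  obtain ⟨η, hη⟩ : ∃ η : ℝ≥0, (η : ℝ) = min (δ / 2) (ε / 3 / (2 * C / δ)) :=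
    ⟨⟨_, by positivity⟩, rfl⟩
  have hη0 : (0 : ℝ) < η := by rw [hη]; positivity
  refine ⟨η, by exact_mod_cast hη0, fun x x' μ ν _ _ hx hw => ?_⟩
  have hd : dist x x' < δ := by
    have : dist x x' ≤ min (δ / 2) (ε / 3 / (2 * C / δ)) := by
      rw [edist_le_coe] at hx
      rw [← hη]
      exact hx
    linarith [min_le_left (δ / 2) (ε / 3 / (2 * C / δ))]
  have h1 : |∫ y, f (x, y) ∂μ - ∫ y, f (x', y) ∂μ| ≤ ε / 3 := by
    rw [← integral_sub (hint x μ) (hint x' μ)]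
    have := norm_integral_le_of_norm_le_const (μ := μ) (f := fun y => f (x, y) - f (x', y))
      (C := ε / 3) (Eventually.of_forall fun y => by
        have := hu (a := (x, y)) (b := (x', y)) (by simpa [Prod.dist_eq] using hd)
        rw [Real.dist_eq] at this
        exact this.le)
    simpa using this
  -- A uniformly continuous bounded function has an affine modulus: points closer than `δ` are
  -- covered by `ε / 3`, and for all others the oscillation `2 * C` is at most `2 * C / δ` times the
  -- distance.
  have h2 : ‖∫ y, f (x', y) ∂μ - ∫ y, f (x', y) ∂ν‖ₑ ≤
      ENNReal.ofReal (ε / 3) + ENNReal.ofReal (2 * C / δ) * wassersteinDist μ ν := by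
    refine enorm_integral_sub_le (hint x' μ) (hint x' ν) (by simpa using by positivity)
      ENNReal.ofReal_ne_top fun y y' => ?_
    rw [edist_dist, ← ENNReal.ofReal_mul (by positivity), ← ENNReal.ofReal_add (by positivity)
      (by positivity), Real.enorm_eq_ofReal_abs]
    refine ENNReal.ofReal_le_ofReal ?_
    by_cases hy : dist y y' < δ
    · have := hu (a := (x', y)) (b := (x', y')) (by simpa [Prod.dist_eq] using hy)
      rw [Real.dist_eq] at this
      have : 0 ≤ 2 * C / δ * dist y y' := by positivity
      linarith
    · have h3 : |f (x', y) - f (x', y')| ≤ 2 * C := by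
        have := abs_sub (f (x', y)) (f (x', y'))
        linarith [hC (x', y), hC (x', y')]
      have h4 : 2 * C ≤ 2 * C / δ * dist y y' := by
        rw [div_mul_eq_mul_div, le_div_iff₀ hδ]
        have := not_lt.1 hy
        gcongr
      linarith
  have h3 : |∫ y, f (x', y) ∂μ - ∫ y, f (x', y) ∂ν| ≤ 2 * (ε / 3) := by
    have h4 : ENNReal.ofReal (2 * C / δ) * wassersteinDist μ ν ≤ ENNReal.ofReal (ε / 3) := by
      calc _ ≤ ENNReal.ofReal (2 * C / δ) * ENNReal.ofReal (ε / 3 / (2 * C / δ)) := by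
            gcongr
            refine hw.trans ?_
            rw [← ENNReal.ofReal_coe_nnreal]
            exact ENNReal.ofReal_le_ofReal (hη.le.trans (min_le_right _ _))
        _ = ENNReal.ofReal (ε / 3) := by
            rw [← ENNReal.ofReal_mul (by positivity)]
            congr 1
            field_simp
    have h5 := h2.trans (add_le_add le_rfl h4)
    rw [← ENNReal.ofReal_add (by positivity) (by positivity), Real.enorm_eq_ofReal_abs,
      ENNReal.ofReal_le_ofReal_iff (by positivity)] at h5
    linarith
  have := abs_sub_le (∫ y, f (x, y) ∂μ) (∫ y, f (x', y) ∂μ) (∫ y, f (x', y) ∂ν)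
  linarith

theorem WassersteinLipschitz.continuous_integral [PseudoMetricSpace X] [CompactSpace X]
    [MeasurableSpace X] [PseudoMetricSpace Y] [CompactSpace Y] [MeasurableSpace Y]
    [OpensMeasurableSpace Y] [SecondCountableTopology Y] {κ : Kernel X Y} [IsMarkovKernel κ]
    (hκ : WassersteinLipschitz κ) {f : X × Y → ℝ} (hf : Continuous f) :
    Continuous fun x => ∫ y, f (x, y) ∂(κ x) := by
  obtain ⟨K, hK⟩ := hκ
  refine Metric.continuous_iff.2 fun x ε hε => ?_
  obtain ⟨η, hη, h⟩ := exists_forall_abs_integral_sub_le hf (half_pos hε)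
  refine ⟨η / (K + 1), by positivity, fun x' hx' => ?_⟩
  rw [Real.dist_eq]
  have hx : edist x' x ≤ ((η / (K + 1) : ℝ≥0) : ℝ≥0∞) := by
    rw [edist_le_coe]
    exact_mod_cast hx'.le
  have hle : η / (K + 1) ≤ η := div_le_self (by positivity) (by simp)
  refine (h x' x (κ x') (κ x) (hx.trans (by exact_mod_cast hle)) ?_).trans_lt (by linarith)
  calc _ ≤ K * edist x' x := hK _ _
    _ ≤ K * ((η / (K + 1) : ℝ≥0) : ℝ≥0∞) := by gcongr
    _ ≤ η := by
      norm_cast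
      rw [mul_div_assoc', div_le_iff₀ (by positivity)]
      rw [mul_comm]
      gcongr
      simp

end Wasserstein

/-! ### Sequential sampling -/

theorem measurable_finSnoc {n : ℕ} {α : Fin (n + 1) → Type*} [∀ i, MeasurableSpace (α i)] :
    Measurable fun z : (∀ i : Fin n, α i.castSucc) × α (Fin.last n) =>
      Fin.snoc (α := α) z.1 z.2 := by
  refine measurable_pi_lambda _ fun i => ?_
  induction i using Fin.lastCases with
  | last => simpa using measurable_snd
  | cast j => simpa [Function.comp_def] using (measurable_pi_apply j).comp measurable_fst

section SequentialLaw

variable {T : ℕ} {X : Fin T → Type}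

theorem measurable_snoc_castLE [∀ t, MeasurableSpace (X t)] {t : ℕ} (ht : t + 1 ≤ T) :
    Measurable fun z : (∀ s : Fin t, X (s.castLE (Nat.le_of_succ_le ht))) × X ⟨t, ht⟩ =>
      Fin.snoc (α := fun s : Fin (t + 1) => X (s.castLE ht)) z.1 z.2 :=
  measurable_finSnoc (α := fun s : Fin (t + 1) => X (s.castLE ht))

instance sequentialLaw.isProbabilityMeasure [∀ t, MeasurableSpace (X t)]
    (κ : ∀ t : Fin T, Kernel (Before X t) (X t)) [∀ t, IsMarkovKernel (κ t)] (t : ℕ)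
    (ht : t ≤ T) : IsProbabilityMeasure (sequentialLaw X κ t ht) := by
  induction t with
  | zero => unfold sequentialLaw; infer_instance
  | succ t ih =>
    have := ih (Nat.le_of_succ_le ht)
    unfold sequentialLaw
    exact Measure.isProbabilityMeasure_map (measurable_snoc_castLE ht).aemeasurable

theorem lintegral_sequentialLaw_succ [∀ t, MeasurableSpace (X t)]
    (κ : ∀ t : Fin T, Kernel (Before X t) (X t)) [∀ t, IsMarkovKernel (κ t)] (t : ℕ)
    (ht : t + 1 ≤ T) {f : (∀ s : Fin (t + 1), X (s.castLE ht)) → ℝ≥0∞} (hf : Measurable f) :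
    ∫⁻ a, f a ∂(sequentialLaw X κ (t + 1) ht) =
      ∫⁻ h, ∫⁻ x, f (Fin.snoc (α := fun s : Fin (t + 1) => X (s.castLE ht)) h x)
        ∂(κ ⟨t, ht⟩ h) ∂(sequentialLaw X κ t (Nat.le_of_succ_le ht)) := by
  rw [sequentialLaw, lintegral_map hf (measurable_snoc_castLE ht)]
  exact Measure.lintegral_compProd (hf.comp (measurable_snoc_castLE ht))

theorem integral_sequentialLaw_succ [∀ t, MeasurableSpace (X t)]
    (κ : ∀ t : Fin T, Kernel (Before X t) (X t)) [∀ t, IsMarkovKernel (κ t)] (t : ℕ)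
    (ht : t + 1 ≤ T) {f : (∀ s : Fin (t + 1), X (s.castLE ht)) → ℝ} (hf : Measurable f)
    {C : ℝ} (hC : ∀ a, |f a| ≤ C) :
    ∫ a, f a ∂(sequentialLaw X κ (t + 1) ht) =
      ∫ h, ∫ x, f (Fin.snoc (α := fun s : Fin (t + 1) => X (s.castLE ht)) h x)
        ∂(κ ⟨t, ht⟩ h) ∂(sequentialLaw X κ t (Nat.le_of_succ_le ht)) := by
  rw [sequentialLaw, integral_map (measurable_snoc_castLE ht).aemeasurable
    hf.aestronglyMeasurable]
  exact Measure.integral_compProd (integrable_of_abs_le (hf.comp (measurable_snoc_castLE ht))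
    fun a => hC _)

/-- A stagewise transport of the transition probabilities transports the sequential law. -/
theorem map_sequentialLaw {Y : Fin T → Type} [∀ t, MeasurableSpace (X t)]
    [∀ t, MeasurableSpace (Y t)]
    (κ : ∀ t : Fin T, Kernel (Before X t) (X t)) [∀ t, IsMarkovKernel (κ t)]
    (η : ∀ t : Fin T, Kernel (Before Y t) (Y t)) [∀ t, IsMarkovKernel (η t)]
    (φ : ∀ (t : ℕ) (ht : t ≤ T), (∀ s : Fin t, X (s.castLE ht)) → ∀ s : Fin t, Y (s.castLE ht))
    (hφ : ∀ t ht, Measurable (φ t ht))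
    (g : ∀ t : Fin T, Before X t → X t → Y t) (hg : ∀ t z, Measurable (g t z))
    (hsucc : ∀ t (ht : t + 1 ≤ T) z x,
      φ (t + 1) ht (Fin.snoc (α := fun s : Fin (t + 1) => X (s.castLE ht)) z x) =
        Fin.snoc (α := fun s : Fin (t + 1) => Y (s.castLE ht))
          (φ t (Nat.le_of_succ_le ht) z) (g ⟨t, ht⟩ z x))
    (hκ : ∀ (t : ℕ) (ht : t + 1 ≤ T) z,
      (κ ⟨t, ht⟩ z).map (g ⟨t, ht⟩ z) = η ⟨t, ht⟩ (φ t (Nat.le_of_succ_le ht) z))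
    (t : ℕ) (ht : t ≤ T) :
    (sequentialLaw X κ t ht).map (φ t ht) = sequentialLaw Y η t ht := by
  induction t with
  | zero =>
    unfold sequentialLaw
    rw [Measure.map_dirac' (hφ 0 ht)]
    congr 1
    exact Subsingleton.elim _ _
  | succ t ih =>
    refine Measure.ext_of_lintegral _ fun f hf => ?_
    have hs := measurable_snoc_castLE (X := Y) ht
    -- Once the last stage is split off on both sides, `hκ` matches the inner integrals and the
    -- induction hypothesis the outer laws.
    rw [lintegral_map hf (hφ _ _), lintegral_sequentialLaw_succ κ t ht (f := fun a => f (φ (t + 1) ht a))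
        (hf.comp (hφ _ _)),
      lintegral_sequentialLaw_succ η t ht hf, ← ih (Nat.le_of_succ_le ht),
      lintegral_map ?_ (hφ _ _)]
    · refine lintegral_congr fun z => ?_
      rw [← hκ t ht z, lintegral_map ?_ (hg _ _)]
      · simp only [hsucc]
      · exact hf.comp (hs.comp measurable_prodMk_left)
    · exact (hf.comp hs).lintegral_kernel_prod_right' (κ := η ⟨t, ht⟩)

/-- Integrals of continuous functions against sequential laws are stable under perturbations of
the transition probabilities that are uniformly small for the Wasserstein distance. -/
theorem tendsto_integral_sequentialLaw [∀ t, PseudoMetricSpace (X t)] [∀ t, CompactSpace (X t)]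
    [∀ t, MeasurableSpace (X t)] [∀ t, BorelSpace (X t)] [∀ t, SecondCountableTopology (X t)]
    {ι : Type*} {l : Filter ι}
    (κ : ∀ t : Fin T, Kernel (Before X t) (X t)) [∀ t, IsMarkovKernel (κ t)]
    (hκ : ∀ t, WassersteinLipschitz (κ t))
    (η : ι → ∀ t : Fin T, Kernel (Before X t) (X t)) [∀ n t, IsMarkovKernel (η n t)]
    (h : ∀ t (ε : ℝ≥0), 0 < ε → ∀ᶠ n in l, ∀ a, wassersteinDist (κ t a) (η n t a) ≤ ε)
    (t : ℕ) (ht : t ≤ T) {f : (∀ s : Fin t, X (s.castLE ht)) → ℝ} (hf : Continuous f) :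
    Tendsto (fun n => ∫ a, f a ∂(sequentialLaw X (η n) t ht)) l
      (𝓝 (∫ a, f a ∂(sequentialLaw X κ t ht))) := by
  induction t with
  | zero => unfold sequentialLaw; exact tendsto_const_nhds
  | succ t ih =>
    obtain ⟨C, hC⟩ : ∃ C : ℝ, ∀ z, |f z| ≤ C := by
      obtain ⟨C, hC⟩ := (isCompact_range hf).isBounded.exists_norm_le
      exact ⟨C, fun z => hC _ ⟨z, rfl⟩⟩
    have hsn : Continuous fun z : Before X ⟨t, ht⟩ × X ⟨t, ht⟩ =>
        f (Fin.snoc (α := fun s : Fin (t + 1) => X (s.castLE ht)) z.1 z.2) :=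
      hf.comp (Continuous.finSnoc (A := fun s : Fin (t + 1) => X (s.castLE ht))
        continuous_fst continuous_snd)
    -- Only the limit `κ` is Lipschitz. Integrating the last stage by `κ` keeps the integrand
    -- continuous, as the induction hypothesis requires; integrating by `η n` need not.
    have hg : Continuous fun a : Before X ⟨t, ht⟩ =>
        ∫ x, f (Fin.snoc (α := fun s : Fin (t + 1) => X (s.castLE ht)) a x) ∂(κ ⟨t, ht⟩ a) :=
      (hκ ⟨t, ht⟩).continuous_integral hsn
    have key := ih (Nat.le_of_succ_le ht) hg
    simp only [integral_sequentialLaw_succ _ t ht hf.measurable hC]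
    refine Metric.tendsto_nhds.2 fun ε hε => ?_
    obtain ⟨δ, hδ, hd⟩ := exists_forall_abs_integral_sub_le hsn (half_pos hε)
    filter_upwards [h ⟨t, ht⟩ δ hδ, Metric.tendsto_nhds.1 key (ε / 2) (half_pos hε)] with n h1 h2
    -- The intermediate value draws the first `t` stages by `η n` and the last one by `κ`.
    refine (dist_triangle _ _ _).trans_lt ((add_lt_add_of_le_of_lt ?_ h2).trans_eq
      (add_halves ε))
    have hint : ∀ κ' : Kernel (Before X ⟨t, ht⟩) (X ⟨t, ht⟩), IsMarkovKernel κ' →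
        Integrable (fun a : Before X ⟨t, ht⟩ =>
          ∫ x, f (Fin.snoc (α := fun s : Fin (t + 1) => X (s.castLE ht)) a x) ∂(κ' a))
          (sequentialLaw X (η n) t (Nat.le_of_succ_le ht)) := by
      intro κ' _
      refine integrable_of_abs_le (C := C) ?_ fun a => ?_
      · exact (hsn.measurable.stronglyMeasurable.integral_kernel_prod_right' (κ := κ')).measurable
      · simpa using norm_integral_le_of_norm_le_const (μ := κ' a) (C := C)
          (f := fun x => f (Fin.snoc (α := fun s : Fin (t + 1) => X (s.castLE ht)) a x))
          (Eventually.of_forall fun x => hC _)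
    rw [Real.dist_eq, ← integral_sub (hint _ inferInstance) (hint _ inferInstance)]
    have := norm_integral_le_of_norm_le_const
      (μ := sequentialLaw X (η n) t (Nat.le_of_succ_le ht))
      (f := fun a : Before X ⟨t, ht⟩ =>
        ∫ x, f (Fin.snoc (α := fun s : Fin (t + 1) => X (s.castLE ht)) a x) ∂(η n ⟨t, ht⟩ a) -
        ∫ x, f (Fin.snoc (α := fun s : Fin (t + 1) => X (s.castLE ht)) a x) ∂(κ ⟨t, ht⟩ a))
      (C := ε / 2) (Eventually.of_forall fun a => by
        rw [Real.norm_eq_abs, abs_sub_comm]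
        exact hd a a (κ ⟨t, ht⟩ a) (η n ⟨t, ht⟩ a) (by simp) (h1 a))
    simpa using this

end SequentialLaw

/-! ### Grids -/

namespace Box

variable (B : Box)

instance (D : ℕ) : Nonempty (B.Idx D) := ⟨fun _ => ⟨0, by positivity⟩⟩

/-- The index at precision `D` of the cell that contains a given cell of precision `D + 1`. -/
def coarsen {D : ℕ} (k : B.Idx (D + 1)) : B.Idx D := fun r =>
  ⟨(k r : ℕ) / 2, by have h := (k r).2; have := pow_succ 2 D; omega⟩

/-- Halving commutes with the floor and sends the cap `2 ^ (D + 1) - 1` to `2 ^ D - 1`, so cells are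
nested, including the closed last one. -/
theorem coarsen_cell (D : ℕ) (x : B.Pt) : B.coarsen (B.cell (D + 1) x) = B.cell D x := by
  funext r
  refine Fin.ext ?_
  simp only [coarsen, cell]
  have h : ⌊(2 : ℝ) ^ (D + 1) * ((x.1 r - B.lo r) / (B.hi r - B.lo r))⌋₊ / 2 =
      ⌊(2 : ℝ) ^ D * ((x.1 r - B.lo r) / (B.hi r - B.lo r))⌋₊ := by
    rw [← Nat.floor_div_ofNat]
    congr 1
    rw [pow_succ]
    ring
  have hp : 2 ^ (D + 1) = 2 * 2 ^ D := by ring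
  have : 0 < 2 ^ D := by positivity
  omega

theorem grid_subset_grid_succ (D : ℕ) : B.grid D ⊆ B.grid (D + 1) := by
  intro x hx
  simp only [grid, Finset.mem_image, Finset.mem_univ, true_and] at hx ⊢
  obtain ⟨k, rfl⟩ := hx
  refine ⟨fun r => ⟨2 * (k r : ℕ), by have := (k r).2; rw [pow_succ]; omega⟩, ?_⟩
  refine Subtype.ext (funext fun r => ?_)
  simp only [gridPt]
  push_cast
  rw [pow_succ]
  field_simp

theorem gridPt_mem_grid (D : ℕ) (k : B.Idx D) : B.gridPt D k ∈ B.grid D := by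
  classical
  exact Finset.mem_image_of_mem _ (Finset.mem_univ k)

instance (D : ℕ) : Nonempty (B.grid D) :=
  ⟨⟨_, B.gridPt_mem_grid D (Classical.arbitrary _)⟩⟩

/-- An upper bound of the side lengths of the box. -/
def width : ℝ := ∑ r, (B.hi r - B.lo r)

theorem side_le_width (r : Fin B.dim) : B.hi r - B.lo r ≤ B.width :=
  Finset.single_le_sum (f := fun r => B.hi r - B.lo r)
    (fun r _ => sub_nonneg.2 (B.lo_le_hi r)) (Finset.mem_univ r)

theorem width_nonneg : 0 ≤ B.width :=
  Finset.sum_nonneg fun r _ => sub_nonneg.2 (B.lo_le_hi r)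

theorem dist_gridPt_cell_le (D : ℕ) (x : B.Pt) :
    dist x (B.gridPt D (B.cell D x)) ≤ B.width / 2 ^ D := by
  have h2 : (0 : ℝ) < 2 ^ D := by positivity
  rw [Subtype.dist_eq, dist_pi_le_iff (div_nonneg B.width_nonneg h2.le)]
  intro r
  have hlo : B.lo r ≤ x.1 r := x.2.1 r
  have hhi : x.1 r ≤ B.hi r := x.2.2 r
  refine le_trans ?_ (div_le_div_of_nonneg_right (B.side_le_width r) h2.le)
  simp only [gridPt, cell, Real.dist_eq]
  rcases (sub_nonneg.2 (B.lo_le_hi r)).eq_or_lt with h0 | hpos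
  · rw [← h0]
    simp only [div_zero, mul_zero, zero_div, add_zero]
    rw [abs_le]; constructor <;> linarith
  set w := B.hi r - B.lo r with hw
  set u := (2 : ℝ) ^ D * ((x.1 r - B.lo r) / w) with hu
  have hu0 : 0 ≤ u := mul_nonneg h2.le (div_nonneg (by linarith) hpos.le)
  have hu1 : u ≤ 2 ^ D := by
    have : (x.1 r - B.lo r) / w ≤ 1 := (div_le_one hpos).2 (by linarith)
    nlinarith
  have hxu : x.1 r = B.lo r + u * (w / 2 ^ D) := by rw [hu]; field_simp; ring
  have hN : ((2 ^ D - 1 : ℕ) : ℝ) = 2 ^ D - 1 := by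
    rw [Nat.cast_sub Nat.one_le_two_pow]; simp
  -- The cap alters the floor only at `u = 2 ^ D`, the right end of the interval, where the
  -- difference is exactly one.
  have hm : |u - ((min ⌊u⌋₊ (2 ^ D - 1) : ℕ) : ℝ)| ≤ 1 := by
    have h1 := Nat.floor_le hu0
    have h3 := (Nat.lt_floor_add_one u).le
    rw [Nat.cast_min, hN, abs_le]
    rcases min_cases (⌊u⌋₊ : ℝ) (2 ^ D - 1) with ⟨h, _⟩ | ⟨h, h'⟩ <;> rw [h] <;>
      constructor <;> linarith
  have : x.1 r - (B.lo r + ((min ⌊u⌋₊ (2 ^ D - 1) : ℕ) : ℝ) * (w / 2 ^ D)) =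
      (u - ((min ⌊u⌋₊ (2 ^ D - 1) : ℕ) : ℝ)) * (w / 2 ^ D) := by rw [hxu]; ring
  rw [this, abs_mul, abs_of_nonneg (by positivity : 0 ≤ w / 2 ^ D)]
  exact mul_le_of_le_one_left (by positivity) hm

instance : CompactSpace B.Pt := isCompact_iff_compactSpace.1 isCompact_Icc

end Box

namespace MultiStageGame

variable {N T : ℕ} (G : MultiStageGame N T) (i : Fin N)

/-! ### Ex-ante utilities -/

instance (β : G.Profile) : IsProbabilityMeasure (G.outcomeLaw β) := by
  unfold outcomeLaw; infer_instance

theorem abs_integral_utility_le {C : ℝ} (hC : ∀ a, |G.utility i a| ≤ C) (μ : Measure G.Outcome)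
    [IsProbabilityMeasure μ] : |∫ a, G.utility i a ∂μ| ≤ C := by
  simpa using norm_integral_le_of_norm_le_const (μ := μ) (f := G.utility i) (C := C)
    (Eventually.of_forall hC)

theorem exAnte_le_stepSup (β : G.Profile) (D : ℕ) (b : G.StepFn i D) :
    G.exAnte i (Function.update β i (G.stepStrategy i D b)) ≤ G.stepSup i D β :=
  le_csSup (Set.finite_range _).bddAbove ⟨b, rfl⟩

theorem exists_exAnte_eq_stepSup (β : G.Profile) (D : ℕ) :
    ∃ b : G.StepFn i D,
      G.exAnte i (Function.update β i (G.stepStrategy i D b)) = G.stepSup i D β :=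
  (Set.range_nonempty _).csSup_mem (Set.finite_range fun b : G.StepFn i D =>
    G.exAnte i (Function.update β i (G.stepStrategy i D b)))

/-- Cells and grid actions are nested, so a step function of precision `D` is, as a strategy, also
one of precision `D + 1`. -/
theorem monotone_stepSup (β : G.Profile) : Monotone fun D => G.stepSup i D β := by
  refine monotone_nat_of_le_succ fun D => ?_
  obtain ⟨b, hb⟩ := G.exists_exAnte_eq_stepSup i β D
  let b' : G.StepFn i (D + 1) := fun t k =>
    ⟨(b t ((G.signal i t).coarsen k)).1, (G.action (some i) t).grid_subset_grid_succ D (b t _).2⟩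
  have : G.stepStrategy i (D + 1) b' = G.stepStrategy i D b := by
    funext t
    refine Subtype.ext (Kernel.ext fun s => ?_)
    simp only [stepStrategy, Kernel.deterministic_apply, b', Box.coarsen_cell]
  rw [← hb, ← this]
  exact G.exAnte_le_stepSup i β (D + 1) b'

theorem exists_tendsto_stepSup (β : G.Profile) :
    ∃ l, Tendsto (fun D => G.stepSup i D β) atTop (𝓝 l) := by
  obtain ⟨C, hC⟩ := G.bounded_utility i
  refine ⟨_, tendsto_atTop_ciSup (G.monotone_stepSup i β) ⟨C, ?_⟩⟩
  rintro _ ⟨D, rfl⟩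
  obtain ⟨b, hb⟩ := G.exists_exAnte_eq_stepSup i β D
  simp only [← hb]
  exact (abs_le.1 (G.abs_integral_utility_le i hC _)).2

theorem pureLipschitz_nonempty : (G.pureLipschitz i).Nonempty := by
  refine ⟨fun t => ⟨Kernel.const _ (Measure.dirac (G.action (some i) t |>.gridPt 0
    (Classical.arbitrary _))), inferInstance⟩, fun t => ⟨⟨0, fun s s' => ?_⟩, fun s => ⟨_, rfl⟩⟩⟩
  simp [wassersteinDist_self]

/-! ### Approximation of Lipschitz strategies by step functions -/

theorem wassersteinLipschitz_moveKernel (h_sig : G.LipschitzSignals) (h_nature : G.LipschitzNature)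
    {β : G.Profile} (hβ : ∀ j t, WassersteinLipschitz (β j t).1) (t : Fin T)
    (j : Option (Fin N)) : WassersteinLipschitz (G.moveKernel β t j) := by
  cases j with
  | none => exact h_nature t
  | some j =>
    obtain ⟨K, hK⟩ := h_sig j t
    exact (hβ j t).comap hK (G.measurable_sig j t)

/-- All factors except that of `i` coincide and contribute zero to the sum of distances. -/
theorem wassersteinDist_moveKernel_update_le (β : G.Profile) (b b' : G.Strategy i) (t : Fin T)
    (a : G.History t) :
    wassersteinDist (piKernel (G.moveKernel (Function.update β i b) t) a)
      (piKernel (G.moveKernel (Function.update β i b') t) a) ≤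
      wassersteinDist ((b t).1 (G.sig i t a)) ((b' t).1 (G.sig i t a)) := by
  refine (wassersteinDist_pi_le (fun j => G.moveKernel (Function.update β i b) t j a)
    (fun j => G.moveKernel (Function.update β i b') t j a)).trans ?_
  rw [Finset.sum_eq_single (some i)]
  · simp [moveKernel]
  · intro j _ hj
    cases j with
    | none => exact wassersteinDist_self _
    | some j =>
      have : j ≠ i := fun h => hj (h ▸ rfl)
      simp [moveKernel, Function.update_of_ne this, wassersteinDist_self]
  · simp

theorem exists_stepFn_wassersteinDist_le {b : G.Strategy i} (hb : b ∈ G.pureLipschitz i) :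
    ∃ c : ∀ D, G.StepFn i D, ∀ t (ε : ℝ≥0), 0 < ε → ∀ᶠ D in atTop, ∀ s,
      wassersteinDist ((b t).1 s) ((G.stepStrategy i D (c D) t).1 s) ≤ ε := by
  have hb1 := fun t => (hb t).1
  choose K hK using hb1
  have hb2 := fun t => (hb t).2
  choose f hf using hb2
  have hfK : ∀ t s s', edist (f t s) (f t s') ≤ K t * edist s s' := fun t s s' => by
    refine (edist_le_wassersteinDist_dirac _ _).trans ?_
    rw [← hf, ← hf]
    exact hK t s s'
  -- Evaluate the Lipschitz map at the lower corner of the signal cell, then round to the grid point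
  -- of the action cell. Both errors are of order `2 ^ (-D)`, uniformly in the signal.
  refine ⟨fun D t k => ⟨_, (G.action (some i) t).gridPt_mem_grid D
    ((G.action (some i) t).cell D (f t ((G.signal i t).gridPt D k)))⟩, fun t ε hε => ?_⟩
  have hlim : Tendsto (fun D : ℕ => ((K t : ℝ) * (G.signal i t).width +
      (G.action (some i) t).width) / 2 ^ D) atTop (𝓝 0) :=
    tendsto_const_nhds.div_atTop (tendsto_pow_atTop_atTop_of_one_lt one_lt_two)
  filter_upwards [hlim.eventually (ge_mem_nhds (show (0 : ℝ) < ε from hε))] with D hD s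
  rw [hf]
  simp only [stepStrategy, Kernel.deterministic_apply]
  refine (wassersteinDist_dirac_le _ _).trans ?_
  rw [edist_le_coe]
  refine NNReal.coe_le_coe.1 (le_trans ?_ hD)
  rw [coe_nndist]
  refine (dist_triangle _ (f t ((G.signal i t).gridPt D ((G.signal i t).cell D s))) _).trans ?_
  have h1 := (G.action (some i) t).dist_gridPt_cell_le D
    (f t ((G.signal i t).gridPt D ((G.signal i t).cell D s)))
  have h2 := (G.signal i t).dist_gridPt_cell_le D s
  have h3 : dist (f t s) (f t ((G.signal i t).gridPt D ((G.signal i t).cell D s))) ≤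
      K t * dist s ((G.signal i t).gridPt D ((G.signal i t).cell D s)) :=
    LipschitzWith.dist_le_mul (hfK t) _ _
  have h4 := mul_le_mul_of_nonneg_left h2 (K t).coe_nonneg
  rw [add_div, mul_div_assoc]
  linarith

/-- Replacing `β i` by `b` makes the whole profile Lipschitz, so stability applies to the
approximating step functions, whose utilities never exceed `stepSup`. -/
theorem exAnte_le_of_tendsto_stepSup (h_sig : G.LipschitzSignals) (h_nature : G.LipschitzNature)
    (h_utility : Continuous (G.utility i)) (β : G.Profile)
    (h_opp : ∀ j, j ≠ i → ∀ t, WassersteinLipschitz (β j t).1)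
    {b : G.Strategy i} (hb : b ∈ G.pureLipschitz i)
    {l : ℝ} (hl : Tendsto (fun D => G.stepSup i D β) atTop (𝓝 l)) :
    G.exAnte i (Function.update β i b) ≤ l := by
  obtain ⟨c, hc⟩ := G.exists_stepFn_wassersteinDist_le i hb
  have hβ : ∀ j t, WassersteinLipschitz (Function.update β i b j t).1 := by
    intro j t
    by_cases h : j = i
    · subst h; simpa using (hb t).1
    · simpa [Function.update_of_ne h] using h_opp j h t
  have hlim := tendsto_integral_sequentialLaw (l := atTop)
    (fun t => piKernel (G.moveKernel (Function.update β i b) t))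
    (fun t => WassersteinLipschitz.piKernel fun j =>
      G.wassersteinLipschitz_moveKernel h_sig h_nature hβ t j)
    (fun D t => piKernel (G.moveKernel (Function.update β i (G.stepStrategy i D (c D))) t))
    (fun t ε hε => by
      filter_upwards [hc t ε hε] with D hD a
      exact (G.wassersteinDist_moveKernel_update_le i β _ _ t a).trans (hD _))
    T le_rfl h_utility
  exact le_of_tendsto_of_tendsto' hlim hl fun D => G.exAnte_le_stepSup i β D (c D)

theorem sSup_pureLipschitz_le (h_sig : G.LipschitzSignals) (h_nature : G.LipschitzNature)
    (h_utility : Continuous (G.utility i)) (β : G.Profile)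
    (h_opp : ∀ j, j ≠ i → ∀ t, WassersteinLipschitz (β j t).1)
    {l : ℝ} (hl : Tendsto (fun D => G.stepSup i D β) atTop (𝓝 l)) :
    sSup ((fun b => G.exAnte i (Function.update β i b)) '' G.pureLipschitz i) ≤ l := by
  refine csSup_le ((G.pureLipschitz_nonempty i).image _) ?_
  rintro _ ⟨b, hb, rfl⟩
  exact G.exAnte_le_of_tendsto_stepSup i h_sig h_nature h_utility β h_opp hb hl

end MultiStageGame

namespace MultiStageGame

variable {N T : ℕ} (G : MultiStageGame N T) (i : Fin N) {D : ℕ}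

/-! ### The path of a step function in a simulation tree -/

/-- The first `t` grid actions that the step function `b` takes in a tree. -/
def nodePath (b : G.StepFn i D) : ∀ (t : ℕ) (ht : t ≤ T),
    (∀ s : Fin t, G.Draws i D (s.castLE ht)) → ∀ s : Fin t, G.GridAct i D (s.castLE ht)
  | 0, _, _ => fun s => s.elim0
  | t + 1, ht, τ =>
      let c := nodePath b t (Nat.le_of_succ_le ht) fun s => τ s.castSucc
      Fin.snoc (α := fun s : Fin (t + 1) => G.GridAct i D (s.castLE ht)) c
        (b ⟨t, ht⟩ (G.sigCell i D ⟨t, ht⟩ (G.nodeHistory i D ⟨t, ht⟩ c fun s => τ s.castSucc)))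

/-- The grid actions that the step function `b` takes in a complete tree. -/
def path (b : G.StepFn i D) (τ : G.Tree i D) (t : Fin T) : G.GridAct i D t :=
  b t (G.sigCell i D t (G.nodeHistory i D t (G.nodePath i b t t.2.le (before τ t)) (before τ t)))

theorem nodePath_eq_path (b : G.StepFn i D) (τ : G.Tree i D) (t : ℕ) (ht : t ≤ T) :
    G.nodePath i b t ht (fun s => τ (s.castLE ht)) = fun s : Fin t => G.path i b τ (s.castLE ht) := by
  induction t with
  | zero => exact funext fun s => s.elim0
  | succ t ih =>
    have h := ih (Nat.le_of_succ_le ht)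
    funext s
    induction s using Fin.lastCases with
    | last =>
      rw [nodePath]
      simp only [Fin.snoc_last]
      rfl
    | cast s =>
      rw [nodePath]
      simp only [Fin.snoc_castSucc]
      exact congrFun h s

/-- The grid actions `c` are the ones that the step function `b` takes in the tree `τ`. -/
def Follows (b : G.StepFn i D) (τ : G.Tree i D) (c : ∀ t, G.GridAct i D t) : Prop :=
  ∀ t, b t (G.sigCell i D t (before (G.branch i D τ c) t)) = c t

theorem before_branch (τ : G.Tree i D) (c : ∀ t, G.GridAct i D t) (t : Fin T) :
    before (G.branch i D τ c) t = G.nodeHistory i D t (before c t) (before τ t) := rfl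

theorem follows_path (b : G.StepFn i D) (τ : G.Tree i D) : G.Follows i b τ (G.path i b τ) := by
  intro t
  rw [before_branch, path]
  congr 3
  exact (G.nodePath_eq_path i b τ t t.2.le).symm

/-- The history before a stage involves only earlier actions of `i`, so the choices of `b` determine
the branch recursively. Each tree thus has exactly one branch that follows `b`. -/
theorem Follows.eq_path {b : G.StepFn i D} {τ : G.Tree i D} {c : ∀ t, G.GridAct i D t}
    (h : G.Follows i b τ c) : c = G.path i b τ := by
  have key : ∀ (n : ℕ) (hn : n < T), c ⟨n, hn⟩ = G.path i b τ ⟨n, hn⟩ := by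
    intro n
    induction n using Nat.strong_induction_on with
    | _ n ih =>
      intro hn
      have hb : before c ⟨n, hn⟩ = before (G.path i b τ) ⟨n, hn⟩ :=
        funext fun s => ih s s.2 (s.2.trans hn)
      rw [← h, ← G.follows_path i b τ ⟨n, hn⟩, before_branch, before_branch, hb]
  exact funext fun t => key t t.2

theorem follows_iff (b : G.StepFn i D) (τ : G.Tree i D) (c : ∀ t, G.GridAct i D t) :
    G.Follows i b τ c ↔ c = G.path i b τ :=
  ⟨fun h => h.eq_path, fun h => h ▸ G.follows_path i b τ⟩

/-! ### The law of the play along a path -/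

theorem measurable_nodeHistory_uncurry (t : Fin T) :
    Measurable fun z : G.Node i D t × Before (G.Draws i D) t =>
      G.nodeHistory i D t z.1 z.2 :=
  measurable_from_prod_countable_right fun c => G.measurable_nodeHistory i D t c

theorem measurable_sigCell (t : Fin T) : Measurable (G.sigCell i D t) :=
  ((G.signal i t).measurable_cell D).comp (G.measurable_sig i t)

theorem measurable_nodePath (b : G.StepFn i D) (t : ℕ) (ht : t ≤ T) :
    Measurable (G.nodePath i b t ht) := by
  induction t with
  | zero => exact measurable_pi_lambda _ fun s => s.elim0
  | succ t ih =>
    have h1 : Measurable fun (τ : ∀ s : Fin (t + 1), G.Draws i D (s.castLE ht)) (s : Fin t) =>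
        τ s.castSucc := measurable_pi_lambda _ fun s => measurable_pi_apply _
    have h2 := (ih (Nat.le_of_succ_le ht)).comp h1
    have h3 := (G.measurable_nodeHistory_uncurry i (D := D) ⟨t, ht⟩).comp (h2.prodMk h1)
    have h4 : Measurable (b ⟨t, ht⟩) := measurable_of_countable _
    exact (measurable_snoc_castLE (X := G.GridAct i D) ht).comp
      (h2.prodMk (h4.comp ((G.measurable_sigCell i ⟨t, ht⟩).comp h3)))

/-- The history along the path of a step function in a tree that is simulated up to stage `t`. -/
def pathHistory (b : G.StepFn i D) (t : ℕ) (ht : t ≤ T)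
    (τ : ∀ s : Fin t, G.Draws i D (s.castLE ht)) :
    ∀ s : Fin t, ActProfile G.action (s.castLE ht) := fun s =>
  G.join i (s.castLE ht) (G.nodePath i b t ht τ s).1
    (τ s fun q => G.nodePath i b t ht τ (q.castLE s.2.le))

theorem measurable_join (t : Fin T) :
    Measurable fun z : (G.action (some i) t).Pt × G.Others i t => G.join i t z.1 z.2 := by
  refine measurable_pi_lambda _ fun j => ?_
  by_cases h : j = some i
  · subst h
    simp only [join, Equiv.piSplitAt, Equiv.coe_fn_symm_mk, dite_true]
    exact measurable_fst
  · simp only [join, Equiv.piSplitAt, Equiv.coe_fn_symm_mk, dif_neg h]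
    exact (measurable_pi_apply _).comp measurable_snd

theorem measurable_join_right (t : Fin T) (x : (G.action (some i) t).Pt) :
    Measurable (G.join i t x) :=
  (G.measurable_join i t).comp measurable_prodMk_left

theorem measurable_pathHistory (b : G.StepFn i D) (t : ℕ) (ht : t ≤ T) :
    Measurable (G.pathHistory i b t ht) := by
  refine measurable_pi_lambda _ fun s => ?_
  -- The node reached depends on the draws, but there are only finitely many nodes, so measurability
  -- can be checked at a fixed one.
  have h : Measurable fun z : (∀ s : Fin t, G.GridAct i D (s.castLE ht)) ×
      (∀ s : Fin t, G.Draws i D (s.castLE ht)) =>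
      G.join i (s.castLE ht) (z.1 s).1 (z.2 s fun q => z.1 (q.castLE s.2.le)) :=
    measurable_from_prod_countable_right fun c =>
      (G.measurable_join_right i _ (c s).1).comp
        ((measurable_pi_apply fun q : Fin (s : ℕ) => c (q.castLE s.2.le)).comp (measurable_pi_apply s))
  exact h.comp ((G.measurable_nodePath i b t ht).prodMk measurable_id)

/-- This is the recursion that `map_sequentialLaw` requires: of all new draws, only the one at the
node reached by `b` matters. -/
theorem pathHistory_snoc (b : G.StepFn i D) (t : ℕ) (ht : t + 1 ≤ T)
    (τ : Before (G.Draws i D) ⟨t, ht⟩) (d : G.Draws i D ⟨t, ht⟩) :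
    G.pathHistory i b (t + 1) ht
        (Fin.snoc (α := fun s : Fin (t + 1) => G.Draws i D (s.castLE ht)) τ d) =
      Fin.snoc (α := fun s : Fin (t + 1) => ActProfile G.action (s.castLE ht))
        (G.pathHistory i b t (Nat.le_of_succ_le ht) τ)
        (G.join i ⟨t, ht⟩
          (b ⟨t, ht⟩ (G.sigCell i D ⟨t, ht⟩ (G.pathHistory i b t (Nat.le_of_succ_le ht) τ))).1
          (d (G.nodePath i b t (Nat.le_of_succ_le ht) τ))) := by
  have hτ : (fun s : Fin t => Fin.snoc (α := fun s : Fin (t + 1) => G.Draws i D (s.castLE ht))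
      τ d s.castSucc) = τ := funext fun s => by simp
  have hc : ∀ s : Fin t, G.nodePath i b (t + 1) ht
      (Fin.snoc (α := fun s : Fin (t + 1) => G.Draws i D (s.castLE ht)) τ d) s.castSucc =
      G.nodePath i b t (Nat.le_of_succ_le ht) τ s := fun s => by
    rw [nodePath]
    simp only [Fin.snoc_castSucc]
  have hl : G.nodePath i b (t + 1) ht
      (Fin.snoc (α := fun s : Fin (t + 1) => G.Draws i D (s.castLE ht)) τ d) (Fin.last t) =
      b ⟨t, ht⟩ (G.sigCell i D ⟨t, ht⟩ (G.pathHistory i b t (Nat.le_of_succ_le ht) τ)) := by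
    rw [nodePath]
    simp only [Fin.snoc_last, Fin.snoc_castSucc]
    rfl
  funext s
  induction s using Fin.lastCases with
  | last =>
    simp only [Fin.snoc_last]
    rw [pathHistory, hl, Fin.snoc_last]
    congr 2
    exact funext fun q => hc q
  | cast s =>
    simp only [Fin.snoc_castSucc]
    rw [pathHistory, hc, Fin.snoc_castSucc]
    unfold pathHistory
    congr 2
    funext q
    exact hc (q.castLE s.2.le)

/-- Against a step function, the factor of `i` in the product law is a Dirac measure and the other
factors are those under `β`; comparison on rectangles suffices. -/
theorem map_join_othersKernel (b : G.StepFn i D) (β : G.Profile) (t : Fin T) (a : G.History t) :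
    (G.othersKernel i β t a).map (G.join i t (b t (G.sigCell i D t a)).1) =
      piKernel (G.moveKernel (Function.update β i (G.stepStrategy i D b)) t) a := by
  have hj := G.measurable_join_right i t (b t (G.sigCell i D t a)).1
  refine (Measure.pi_eq (μ := fun j =>
    G.moveKernel (Function.update β i (G.stepStrategy i D b)) t j a) fun s hs => ?_).symm
  rw [Measure.map_apply hj (MeasurableSet.univ_pi hs),
    ← Finset.mul_prod_erase Finset.univ _ (Finset.mem_univ (some i)),
    Finset.prod_subtype (p := fun j => j ≠ some i) _ (by simp)]
  have hi : G.moveKernel (Function.update β i (G.stepStrategy i D b)) t (some i) a =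
      Measure.dirac (b t (G.sigCell i D t a)).1 := by
    simp only [moveKernel, Kernel.comap_apply, Function.update_self, stepStrategy,
      Kernel.deterministic_apply]
    rfl
  have hne : ∀ j : {j : Option (Fin N) // j ≠ some i},
      G.moveKernel (Function.update β i (G.stepStrategy i D b)) t j.1 a =
        G.moveKernel β t j.1 a := by
    rintro ⟨j, hj⟩
    cases j with
    | none => rfl
    | some j =>
      have : j ≠ i := fun h => hj (h ▸ rfl)
      simp [moveKernel, Function.update_of_ne this]
  simp only [hi, hne, Measure.dirac_apply' _ (hs (some i))]
  have hpi : G.othersKernel i β t a (Set.univ.pi fun j => s j.1) =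
      ∏ j : {j : Option (Fin N) // j ≠ some i}, G.moveKernel β t j.1 a (s j.1) :=
    Measure.pi_pi _ _
  rw [← hpi]
  have hself : ∀ y, G.join i t (b t (G.sigCell i D t a)).1 y (some i) =
      (b t (G.sigCell i D t a)).1 := fun y => by
    simp [join, Equiv.piSplitAt]
  have hother : ∀ y (j : {j : Option (Fin N) // j ≠ some i}),
      G.join i t (b t (G.sigCell i D t a)).1 y j.1 = y j := fun y j => by
    simp [join, Equiv.piSplitAt, j.2]
  by_cases hx : (b t (G.sigCell i D t a)).1 ∈ s (some i)
  · rw [Set.indicator_of_mem hx, Pi.one_apply, one_mul]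
    congr 1
    ext y
    simp only [Set.mem_preimage, Set.mem_univ_pi]
    refine ⟨fun h j => hother y j ▸ h j.1, fun h j => ?_⟩
    by_cases hj : j = some i
    · subst hj; rw [hself]; exact hx
    · rw [hother y ⟨j, hj⟩]; exact h ⟨j, hj⟩
  · rw [Set.indicator_of_notMem hx, zero_mul]
    refine measure_mono_null (fun y hy => hx ?_) measure_empty
    rw [← hself y]
    exact hy (some i) (Set.mem_univ _)

/-- The marginal of a product measure at the coordinate `c` is its factor, so the draws at other
nodes integrate out. -/
theorem map_join_piKernel_othersKernel (β : G.Profile) (t : Fin T) (c : G.Node i D t)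
    (τ : Before (G.Draws i D) t) (x : (G.action (some i) t).Pt) :
    (piKernel (fun c : G.Node i D t => (G.othersKernel i β t).comap (G.nodeHistory i D t c)
      (G.measurable_nodeHistory i D t c)) τ).map (fun d => G.join i t x (d c)) =
      (G.othersKernel i β t (G.nodeHistory i D t c τ)).map (G.join i t x) := by
  have hm := fun c : G.Node i D t => IsMarkovKernel.isProbabilityMeasure
    (κ := (G.othersKernel i β t).comap (G.nodeHistory i D t c)
      (G.measurable_nodeHistory i D t c)) τ
  have he := (measurePreserving_eval (fun c : G.Node i D t =>
    (G.othersKernel i β t).comap (G.nodeHistory i D t c)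
      (G.measurable_nodeHistory i D t c) τ) c).map_eq
  have := congrArg (Measure.map (G.join i t x)) he
  exact (Measure.map_map (G.measurable_join_right i t x)
    (measurable_pi_apply c)).symm.trans this

theorem branch_path (b : G.StepFn i D) (τ : G.Tree i D) :
    G.branch i D τ (G.path i b τ) = G.pathHistory i b T le_rfl τ := by
  have h : ∀ s : Fin T, G.nodePath i b T le_rfl τ s = G.path i b τ s := fun s =>
    congrFun (G.nodePath_eq_path i b τ T le_rfl) s
  funext t
  simp only [branch, pathHistory]
  rw [h]
  congr 2
  exact funext fun q => (h _).symm

/-- One tree carries the play of all step functions at once, each with its correct law. Dependence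
between the branches of a tree is harmless, since only marginal laws enter. -/
theorem map_path_treeLaw (b : G.StepFn i D) (β : G.Profile) :
    (G.treeLaw i D β).map (fun τ => G.branch i D τ (G.path i b τ)) =
      G.outcomeLaw (Function.update β i (G.stepStrategy i D b)) := by
  have h := map_sequentialLaw (X := G.Draws i D) (Y := ActProfile G.action)
    (fun t => piKernel fun c : G.Node i D t =>
      (G.othersKernel i β t).comap (G.nodeHistory i D t c) (G.measurable_nodeHistory i D t c))
    (fun t => piKernel (G.moveKernel (Function.update β i (G.stepStrategy i D b)) t))
    (G.pathHistory i b) (G.measurable_pathHistory i b)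
    (fun t τ d => G.join i t
      (b t (G.sigCell i D t (G.pathHistory i b t t.2.le τ))).1 (d (G.nodePath i b t t.2.le τ)))
    (fun t τ => (G.measurable_join_right i t _).comp
      (measurable_pi_apply (G.nodePath i b t t.2.le τ)))
    (G.pathHistory_snoc i b)
    (fun t ht τ => (G.map_join_piKernel_othersKernel i β ⟨t, ht⟩ _ τ _).trans
      (G.map_join_othersKernel i b β ⟨t, ht⟩ _))
    T le_rfl
  rw [treeLaw, outcomeLaw, ← h]
  congr 1
  exact funext fun τ => G.branch_path i b τ

end MultiStageGame

namespace MultiStageGame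

variable {N T : ℕ} (G : MultiStageGame N T) (i : Fin N) {D : ℕ}

/-! ### Backward induction on the simulated data -/

section Data

variable {M : ℕ} (τ : Fin M → G.Tree i D)

/-- The grid cell of the stage-`t` signal along a simulated history. -/
def branchCell (t : Fin T) (l : Fin M × (∀ t, G.GridAct i D t)) : (G.signal i t).Idx D :=
  G.sigCell i D t (before (G.branch i D (τ l.1) l.2) t)

/-- The total utility of a step function on the simulated data. -/
def pathUtility (b : G.StepFn i D) : ℝ :=
  ∑ m, G.utility i (G.branch i D (τ m) (G.path i b (τ m)))

open Classical in
theorem pathUtility_eq_sum_cells (b : G.StepFn i D) (t : Fin T) :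
    G.pathUtility i τ b = ∑ k, ∑ l : Fin M × (∀ t, G.GridAct i D t) with
      G.Follows i b (τ l.1) l.2 ∧ G.branchCell i τ t l = k,
        G.utility i (G.branch i D (τ l.1) l.2) := by
  have h : G.pathUtility i τ b = ∑ l : Fin M × (∀ t, G.GridAct i D t) with
      G.Follows i b (τ l.1) l.2, G.utility i (G.branch i D (τ l.1) l.2) := by
    rw [Finset.sum_filter, Fintype.sum_prod_type]
    refine Finset.sum_congr rfl fun m _ => ?_
    simp [follows_iff]
  rw [h, ← Finset.sum_fiberwise _ (G.branchCell i τ t)]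
  simp only [Finset.filter_filter]

/-- A cell without visits has no simulated histories, so the default value of `condUtility` does no
harm. -/
theorem sum_simulated (b : G.StepFn i D) (t : Fin T) (k : (G.signal i t).Idx D)
    (x : G.GridAct i D t) :
    ∑ l ∈ G.simulated i D τ b t k x, G.utility i (G.branch i D (τ l.1) l.2) =
      G.visits i D τ t k * G.condUtility i D τ b t k x := by
  by_cases hv : G.visits i D τ t k = 0
  · have he : G.simulated i D τ b t k x = ∅ := by
      refine Finset.eq_empty_of_forall_notMem fun l hl => ?_
      simp only [simulated, Finset.mem_filter] at hl
      rw [visits, Nat.card_eq_zero] at hv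
      rcases hv with hv | hv
      · exact hv.elim ⟨(l.1, before l.2 t), hl.2.1⟩
      · exact not_finite_iff_infinite.2 hv inferInstance
    rw [he, hv]
    simp
  · rw [condUtility]
    field_simp

open Classical in
-- `simulated` leaves the actions before `t` unrestricted. If every history that reaches `k` agrees
-- with `d` before `t`, following `d` imposes nothing further.
theorem filter_follows_eq_simulated (b d : G.StepFn i D) (t : Fin T) (k : (G.signal i t).Idx D)
    (hlater : ∀ r, t < r → d r = b r)
    (hearlier : ∀ l, G.branchCell i τ t l = k → ∀ s < t, d s (G.branchCell i τ s l) = l.2 s) :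
    (Finset.univ.filter fun l : Fin M × (∀ t, G.GridAct i D t) =>
      G.Follows i d (τ l.1) l.2 ∧ G.branchCell i τ t l = k) =
      G.simulated i D τ b t k (d t k) := by
  ext l
  simp only [simulated, Finset.mem_filter, Finset.mem_univ, true_and]
  constructor
  · rintro ⟨h, hk⟩
    exact ⟨hk, by rw [← h t]; exact congrArg (d t) hk, fun r hr => by rw [← hlater r hr, h r]⟩
  · rintro ⟨hk, hx, h⟩
    refine ⟨fun s => ?_, hk⟩
    rcases lt_trichotomy s t with hs | rfl | hs
    · exact hearlier l hk s hs
    · rw [hx, hk]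
    · rw [hlater s hs, h s hs]

theorem branch_self (τ : G.Tree i D) (c : ∀ t, G.GridAct i D t) (t : Fin T) :
    G.branch i D τ c t (some i) = (c t).1 := by
  simp [branch, join, Equiv.piSplitAt]

/-- Simulated histories that reach the same cell agree on earlier actions and cells. -/
theorem GridRecall.eq_of_branchCell_eq {G : MultiStageGame N T} {i : Fin N}
    (h_grid : G.GridRecall i) {τ : Fin M → G.Tree i D} {s t : Fin T} (hst : s < t)
    {l l' : Fin M × (∀ t, G.GridAct i D t)}
    (h : G.branchCell i τ t l = G.branchCell i τ t l') :
    l.2 s = l'.2 s ∧ G.branchCell i τ s l = G.branchCell i τ s l' := by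
  have := h_grid D s t hst (G.branch i D (τ l.1) l.2) (G.branch i D (τ l'.1) l'.2)
    (fun r _ => by rw [branch_self, branch_self]; exact ⟨(l.2 r).2, (l'.2 r).2⟩) h
  rw [branch_self, branch_self] at this
  exact ⟨Subtype.ext this.1, this.2⟩

/-- The step function that follows `b'` in the first `n` stages and `b` afterwards. -/
def switch (b' b : G.StepFn i D) (n : ℕ) : G.StepFn i D :=
  fun s k => if (s : ℕ) < n then b' s k else b s k

/-- The two step functions differ only in stage `t`, so the comparison can be made cell by cell. By
grid recall, the histories that reach a cell share their earlier actions and cells: either all agree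
with `b'` before `t`, or none does. In the first case both sums are visits times conditional
utility, which `b` maximizes; in the second both are empty. -/
theorem pathUtility_switch_succ_le {G : MultiStageGame N T} {i : Fin N}
    (h_grid : G.GridRecall i) {τ : Fin M → G.Tree i D} {b : G.StepFn i D}
    (hb : G.IsBackwardInduction i D τ b) (b' : G.StepFn i D) (t : Fin T) :
    G.pathUtility i τ (G.switch i b' b (t + 1)) ≤ G.pathUtility i τ (G.switch i b' b t) := by
  classical
  rw [G.pathUtility_eq_sum_cells i τ _ t, G.pathUtility_eq_sum_cells i τ _ t]
  refine Finset.sum_le_sum fun k _ => ?_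
  have hlt : ∀ s < t, ∀ k, G.switch i b' b t s k = b' s k := fun s hs k =>
    if_pos (show (s : ℕ) < t from hs)
  have hlt' : ∀ s < t, ∀ k, G.switch i b' b (t + 1) s k = b' s k := fun s hs k =>
    if_pos (show (s : ℕ) < t + 1 from Nat.lt_succ_of_lt hs)
  by_cases hex : ∃ l₀, G.branchCell i τ t l₀ = k ∧
      ∀ s < t, b' s (G.branchCell i τ s l₀) = l₀.2 s
  · obtain ⟨l₀, hk, h₀⟩ := hex
    have hall : ∀ l, G.branchCell i τ t l = k →
        ∀ s < t, b' s (G.branchCell i τ s l) = l.2 s := fun l hl s hs => by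
      obtain ⟨h1, h2⟩ := h_grid.eq_of_branchCell_eq hs (hl.trans hk.symm)
      rw [h1, h2, h₀ s hs]
    rw [G.filter_follows_eq_simulated i τ b (G.switch i b' b (t + 1)) t k
      (fun r hr => funext fun k => if_neg (by
        have : (t : ℕ) < r := hr
        omega))
      (fun l hl s hs => (hlt' s hs _).trans (hall l hl s hs)),
      G.filter_follows_eq_simulated i τ b (G.switch i b' b t) t k
      (fun r hr => funext fun k => if_neg (by
        have : (t : ℕ) < r := hr
        omega))
      (fun l hl s hs => (hlt s hs _).trans (hall l hl s hs)), sum_simulated, sum_simulated]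
    have e : G.switch i b' b t t k = b t k := if_neg (lt_irrefl _)
    rw [e]
    exact mul_le_mul_of_nonneg_left (hb t k _) (Nat.cast_nonneg _)
  · rw [Finset.filter_false_of_mem, Finset.filter_false_of_mem]
    · rintro l - ⟨h, hk⟩
      exact hex ⟨l, hk, fun s hs => by rw [← h s, hlt s hs]; rfl⟩
    · rintro l - ⟨h, hk⟩
      exact hex ⟨l, hk, fun s hs => by rw [← h s, hlt' s hs]; rfl⟩

/-- Backward induction maximizes the utility on the simulated data. -/
theorem pathUtility_le_of_isBackwardInduction {G : MultiStageGame N T} {i : Fin N}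
    (h_grid : G.GridRecall i) {τ : Fin M → G.Tree i D} {b : G.StepFn i D}
    (hb : G.IsBackwardInduction i D τ b) (b' : G.StepFn i D) :
    G.pathUtility i τ b' ≤ G.pathUtility i τ b := by
  -- The stages of `b'` are replaced by those of `b` from the last to the first, and no replacement
  -- lowers the utility.
  have key : ∀ n ≤ T, G.pathUtility i τ (G.switch i b' b n) ≤ G.pathUtility i τ b := by
    intro n
    induction n with
    | zero =>
      intro _
      have : G.switch i b' b 0 = b := funext fun s => funext fun k => if_neg (Nat.not_lt_zero _)
      rw [this]
    | succ n ih =>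
      intro hn
      exact (pathUtility_switch_succ_le h_grid hb b' ⟨n, hn⟩).trans (ih (Nat.le_of_succ_le hn))
  have h : G.switch i b' b T = b' := funext fun s => funext fun k => if_pos s.2
  have := key T le_rfl
  rwa [h] at this

/-- The first stage has a single node, the empty sequence of actions, so every tree counts once. -/
theorem sum_visits_first : ∑ k, G.visits i D τ ⟨0, G.T_pos⟩ k = M := by
  have h : ∀ k, G.visits i D τ ⟨0, G.T_pos⟩ k =
      Nat.card {x : Fin M × G.Node i D ⟨0, G.T_pos⟩ // G.sigCell i D ⟨0, G.T_pos⟩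
        (G.nodeHistory i D ⟨0, G.T_pos⟩ x.2 (before (τ x.1) ⟨0, G.T_pos⟩)) = k} := fun k => rfl
  simp only [h]
  rw [← Nat.card_sigma, Nat.card_congr (Equiv.sigmaFiberEquiv _), Nat.card_prod]
  have : Unique (G.Node i D ⟨0, G.T_pos⟩) :=
    inferInstanceAs (Unique (∀ s : Fin 0, G.GridAct i D (s.castLE (Nat.zero_le _))))
  simp

/-- The visit counts cancel against the denominators of the conditional utilities. In the first
stage there are no earlier actions to be checked. -/
theorem estimatedBestResponse_eq (b : G.StepFn i D) :
    G.estimatedBestResponse i D τ b = G.pathUtility i τ b / M := by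
  classical
  have hM : ∑ k, (G.visits i D τ ⟨0, G.T_pos⟩ k : ℝ) = M := by
    exact_mod_cast G.sum_visits_first i τ
  rw [estimatedBestResponse, hM, G.pathUtility_eq_sum_cells i τ b ⟨0, G.T_pos⟩, Finset.sum_div]
  refine Finset.sum_congr rfl fun k _ => ?_
  rw [G.filter_follows_eq_simulated i τ b b ⟨0, G.T_pos⟩ k (fun _ _ => rfl)
    (fun l _ s hs => (Nat.not_lt_zero _ (show (s : ℕ) < 0 from hs)).elim), sum_simulated]
  ring

end Data

/-! ### Laws of large numbers -/

section LargeNumbers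

variable {Ω : Type*} [MeasurableSpace Ω] {P : Measure Ω}

/-- The strong law of large numbers for a bounded function of i.i.d. random elements. -/
theorem ae_tendsto_average_of_hasLaw [IsProbabilityMeasure P] {E : Type*} [MeasurableSpace E]
    {μ : Measure E} {A : ℕ → Ω → E} (h_indep : iIndepFun A P) (h_law : ∀ m, HasLaw (A m) μ P)
    {f : E → ℝ} (hf : Measurable f) {C : ℝ} (hC : ∀ x, |f x| ≤ C) :
    ∀ᵐ ω ∂P, Tendsto (fun M : ℕ => (∑ m : Fin M, f (A m ω)) / M) atTop (𝓝 (∫ x, f x ∂μ)) := by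
  have hid : ∀ m, IdentDistrib (A m) (A 0) P P := fun m =>
    ⟨(h_law m).aemeasurable, (h_law 0).aemeasurable, by rw [(h_law m).map_eq, (h_law 0).map_eq]⟩
  have h := strong_law_ae_real (μ := P) (fun m ω => f (A m ω))
    (Integrable.of_bound (hf.comp_aemeasurable (h_law 0).aemeasurable).aestronglyMeasurable C
      (Eventually.of_forall fun ω => hC _))
    (fun m n hmn => (h_indep.indepFun hmn).comp hf hf)
    (fun m => (hid m).comp hf)
  have hint : ∫ ω, f (A 0 ω) ∂P = ∫ x, f x ∂μ :=
    (h_law 0).integral_comp hf.aestronglyMeasurable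
  simp only [Finset.sum_range] at h
  rw [← hint]
  exact h

/-- The maximizer depends on the data, so convergence is needed uniformly over step functions; their
finiteness provides it. The estimate is at most the utility of its own step function plus `ε`, and
at least the average of an optimal one. -/
theorem ae_tendsto_estimatedBestResponse [IsProbabilityMeasure P] (h_grid : G.GridRecall i)
    (β : G.Profile) {A : ℕ → Ω → G.Tree i D} (h_indep : iIndepFun A P)
    (h_law : ∀ m, HasLaw (A m) (G.treeLaw i D β) P) {b : ℕ → Ω → G.StepFn i D}
    (h_b : ∀ M ω, G.IsBackwardInduction i D (fun m : Fin M => A m ω) (b M ω)) :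
    ∀ᵐ ω ∂P, Tendsto
      (fun M => G.estimatedBestResponse i D (fun m : Fin M => A m ω) (b M ω)) atTop
      (𝓝 (G.stepSup i D β)) := by
  obtain ⟨C, hC⟩ := G.bounded_utility i
  have hmeas : ∀ c : G.StepFn i D, Measurable fun τ => G.branch i D τ (G.path i c τ) := fun c => by
    simp only [branch_path]
    exact G.measurable_pathHistory i c T le_rfl
  have hlln : ∀ c : G.StepFn i D, ∀ᵐ ω ∂P, Tendsto
      (fun M : ℕ => G.pathUtility i (fun m : Fin M => A m ω) c / M) atTop
      (𝓝 (G.exAnte i (Function.update β i (G.stepStrategy i D c)))) := fun c => by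
    have := ae_tendsto_average_of_hasLaw h_indep h_law
      ((G.measurable_utility i).comp (hmeas c)) (C := C) fun τ => hC _
    rw [exAnte, ← G.map_path_treeLaw i c β, integral_map (hmeas c).aemeasurable
      (G.measurable_utility i).aestronglyMeasurable]
    exact this
  filter_upwards [ae_all_iff.2 hlln] with ω hω
  simp only [estimatedBestResponse_eq]
  refine Metric.tendsto_nhds.2 fun ε hε => ?_
  have hev := eventually_all.2 fun c => Metric.tendsto_nhds.1 (hω c) ε hε
  filter_upwards [hev] with M hM
  obtain ⟨c, hc⟩ := G.exists_exAnte_eq_stepSup i β D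
  have h1 := hM c
  have h2 := hM (b M ω)
  have h3 := G.exAnte_le_stepSup i β D (b M ω)
  have h4 : G.pathUtility i (fun m : Fin M => A m ω) c / M ≤
      G.pathUtility i (fun m : Fin M => A m ω) (b M ω) / M :=
    div_le_div_of_nonneg_right (pathUtility_le_of_isBackwardInduction h_grid (h_b M ω) c)
      (Nat.cast_nonneg _)
  rw [Real.dist_eq, abs_lt] at *
  constructor <;> linarith

end LargeNumbers

end MultiStageGame

end

/-! ### The main theorem -/

theorem theorem1 {N T : ℕ} (G : MultiStageGame N T) (i : Fin N)
    (h_recall : G.PerfectRecall) (h_grid : G.GridRecall i)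
    (h_sig : G.LipschitzSignals) (h_nature : G.LipschitzNature)
    (h_utility : Continuous (G.utility i))
    (β : G.Profile) (h_opp : ∀ j, j ≠ i → ∀ t, WassersteinLipschitz (β j t).1)
    {Ω : Type*} [MeasurableSpace Ω] (P : Measure Ω) [IsProbabilityMeasure P]
    -- for every precision `D`, i.i.d. simulation trees
    (A : ∀ D : ℕ, ℕ → Ω → G.Tree i D) (h_A_indep : ∀ D, iIndepFun (A D) P)
    (h_A_law : ∀ D m, HasLaw (A D m) (G.treeLaw i D β) P)
    -- i.i.d. roll-outs of the strategy profile itself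
    (B : ℕ → Ω → G.Outcome) (h_B_indep : iIndepFun B P)
    (h_B_law : ∀ m, HasLaw (B m) (G.outcomeLaw β) P)
    -- step functions from backward induction on the first `M` trees, with any tie-breaking
    (b : ∀ D : ℕ, ℕ → Ω → G.StepFn i D)
    (h_b : ∀ D M ω, G.IsBackwardInduction i D (fun m : Fin M => A D m ω) (b D M ω)) :
    (∃ e : ℝ, e ≤ 0 ∧ Tendsto (fun D => G.discretizationError i D β) atTop (𝓝 e)) ∧
    (∀ D, ∀ᵐ ω ∂P, Tendsto
      (fun M => G.simulationError i D (fun m : Fin M => A D m ω) β (b D M ω)) atTop (𝓝 0)) ∧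
    (∀ᵐ ω ∂P, ∃ (L : ℕ → ℝ) (l : ℝ),
      (∀ D, Tendsto
        (fun M => G.estimatedLoss i D (fun m : Fin M => A D m ω) (b D M ω)
          (fun m : Fin M => B m ω)) atTop (𝓝 (L D))) ∧
      Tendsto L atTop (𝓝 l) ∧ G.utilityLoss i β ≤ l) := by
  obtain ⟨C, hC⟩ := G.bounded_utility i
  obtain ⟨l, hl⟩ := G.exists_tendsto_stepSup i β
  have hle := G.sSup_pureLipschitz_le i h_sig h_nature h_utility β h_opp hl
  have hA := fun D => G.ae_tendsto_estimatedBestResponse i h_grid β (h_A_indep D) (h_A_law D)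
    (h_b D)
  have hB := MultiStageGame.ae_tendsto_average_of_hasLaw h_B_indep h_B_law
    (G.measurable_utility i) hC
  refine ⟨⟨_, sub_nonpos.2 hle, hl.const_sub _⟩, fun D => ?_, ?_⟩
  · filter_upwards [hA D] with ω hω
    simpa [MultiStageGame.simulationError] using hω.const_sub (G.stepSup i D β)
  · filter_upwards [ae_all_iff.2 hA, hB] with ω hω hω'
    -- The null sets for all precisions `D` were united, so a single `ω` serves every `D`.
    exact ⟨fun D => G.stepSup i D β - G.exAnte i β, l - G.exAnte i β,
      fun D => (hω D).sub hω', hl.sub_const _, sub_le_sub_right hle _⟩
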